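/- Let $X$ be a complex manifold (Hausdorff, with a countable basis, finite-dimensional), let $K\subset X$ be a compact set and let $p\ge 0$. For an open set $U\subset X$ let $H^{p,q}_{\bar\partial}(U)$ (respectively $H^{p,q}_{\bar\partial,c}(U)$) denote the $q$-th cohomology of the complex of $C^\infty$ forms of type $(p,\bullet)$ on $U$ (respectively of those with compact support in $U$) with the differential $\bar\partial$, these groups being $0$ for $q<0$, and let $$H^{p,q}_{\bar\partial}[K]=\varinjlim_{V\supset K}H^{p,q}_{\bar\partial}(V),$$ where $V$ runs through the open neighbourhoods of $K$ in $X$. Let $i^*:H^{p,q}_{\bar\partial,c}(X\smallsetminus K)\to H^{p,q}_{\bar\partial,c}(X)$ be induced by extension of forms by zero, and let $j^*$ be the composition $H^{p,q}_{\bar\partial,c}(X)\to H^{p,q}_{\bar\partial}(X)\to H^{p,q}_{\bar\partial}[K]$ of the natural maps. Then for every $q\ge 0$ there is a unique linear map $\gamma^*:H^{p,q}_{\bar\partial}[K]\to H^{p,q+1}_{\bar\partial,c}(X\smallsetminus K)$ such that the following holds for every relatively compact open neighbourhood $V_1$ of $K$, every $\bar\partial$-closed $C^\infty$ form $\eta$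 of type $(p,q)$ on $V_1$ and every $C^\infty$ partition of unity $\{\rho_0,\rho_1\}$ subordinate to the covering $\{X\smallsetminus K,V_1\}$ of $X$: the form $\eta\wedge\bar\partial\rho_1$, extended by zero outside $V_1$, is a $\bar\partial$-closed $(p,q+1)$-form with compact support in $X\smallsetminus K$, and $\gamma^*$ maps the class of $\eta$ in $H^{p,q}_{\bar\partial}[K]$ to $[\eta\wedge\bar\partial\rho_1]$. With these maps, the sequence $$0\to H^{p,0}_{\bar\partial,c}(X\smallsetminus K)\to\cdots\to H^{p,q}_{\bar\partial,c}(X\smallsetminus K)\xrightarrow{\,i^*\,}H^{p,q}_{\bar\partial,c}(X)\xrightarrow{\,j^*\,}H^{p,q}_{\bar\partial}[K]\xrightarrow{\,\gamma^*\,}H^{p,q+1}_{\bar\partial,c}(X\smallsetminus K)\xrightarrow{\,i^*\,}H^{p,q+1}_{\bar\partial,c}(X)\to\cdots$$ is exact. -/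

import Mathlib

open scoped Manifold ContDiff Topology
open TopologicalSpace Set

noncomputable section

namespace Dolbeault

/-! ### Differential forms on a complex manifold

`X` is a manifold modelled on a complex normed space `E` through `ChartedSpace E X`.  As everywhere
in Mathlib, the tangent space `TangentSpace 𝓘(ℂ, E) x` at `x` is the vector space `E`, a tangent
vector being represented by its coordinates in the preferred chart `chartAt E x` at `x`. -/

section Linear

variable {E F : Type*} [NormedAddCommGroup E] [NormedSpace ℂ E]
  [NormedAddCommGroup F] [NormedSpace ℂ F]

/-- The alternating real `k`-linear maps on `E` with values in `F`. -/
abbrev Alt (E F : Type*) [NormedAddCommGroup E] [NormedSpace ℂ E] [NormedAddCommGroup F]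
    [NormedSpace ℂ F] (k : ℕ) : Type _ := E [⋀^Fin k]→L[ℝ] F

/-- Multiplication by `i` on a complex normed space, as a real continuous linear map. -/
def mulI (E : Type*) [NormedAddCommGroup E] [NormedSpace ℂ E] : E →L[ℝ] E :=
  Complex.I • ContinuousLinearMap.id ℝ E

/-- The conjugate-linear part `v ↦ (L v + i L (i v)) / 2` of a real linear map `L` between complex
vector spaces. -/
def conjPart (L : E →L[ℝ] F) : E →L[ℝ] F :=
  (2⁻¹ : ℂ) • (L + Complex.I • L.comp (mulI E))

theorem conjPart_apply (L : E →L[ℝ] F) (v : E) :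
    conjPart L v = (2⁻¹ : ℂ) • (L v + Complex.I • L (Complex.I • v)) := rfl

theorem conjPart_add (L M : E →L[ℝ] F) : conjPart (L + M) = conjPart L + conjPart M := by
  ext v
  simp only [conjPart_apply, _root_.add_apply, smul_add]
  abel

theorem conjPart_smul (c : ℂ) (L : E →L[ℝ] F) : conjPart (c • L) = c • conjPart L := by
  ext v
  simp only [conjPart_apply, _root_.smul_apply, smul_add, smul_smul]
  congr 2 <;> ring

/-- A real alternating `(p + q)`-form `α` on a complex vector space is of type `(p, q)` if
`α (c v₁, …, c vₖ) = (c ^ p * conj c ^ q) • α (v₁, …, vₖ)` for every complex number `c`; these are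
the linear combinations of the forms `dz_I ∧ dz̄_J` with `|I| = p` and `|J| = q`. -/
def IsType (p q : ℕ) (α : Alt E F (p + q)) : Prop :=
  ∀ (c : ℂ) (v : Fin (p + q) → E),
    α (fun i => c • v i) = (c ^ p * (starRingEnd ℂ) c ^ q) • α v

/-- The exterior product `η ∧ β` of a `k`-form `η` and a `1`-form `β`. -/
def wedgeOne {k : ℕ} (η : Alt E F k) (β : Alt E ℂ 1) :
    Alt E F (k + 1) :=
  ((-1 : ℂ) ^ k) • ContinuousAlternatingMap.alternatizeUncurryFin
    (((ContinuousAlternatingMap.ofSubsingleton ℝ E ℂ (0 : Fin 1)).symm β).smulRight η)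

/-- `(η ∧ β) (v₀, …, vₖ) = ∑ᵢ (-1) ^ (k - i) η (v₀, …, v̂ᵢ, …, vₖ) β (vᵢ)`. -/
theorem wedgeOne_apply {k : ℕ} (η : Alt E F k) (β : Alt E ℂ 1)
    (v : Fin (k + 1) → E) :
    wedgeOne η β v =
      ∑ i : Fin (k + 1), ((-1 : ℂ) ^ (k + i : ℕ) * β (fun _ => v i)) • η (i.removeNth v) := by
  have h : ∀ w : E, (ContinuousAlternatingMap.ofSubsingleton ℝ E ℂ (0 : Fin 1)).symm β w
      = β (fun _ => w) := fun w => rfl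
  simp only [wedgeOne, ContinuousAlternatingMap.smul_apply,
    ContinuousAlternatingMap.alternatizeUncurryFin_apply, ContinuousLinearMap.smulRight_apply, h,
    Finset.smul_sum]
  refine Finset.sum_congr rfl fun i _ => ?_
  rw [pow_add, mul_assoc, mul_smul, mul_smul]
  congr 1
  rcases neg_one_pow_eq_or ℤ (i : ℕ) with hi | hi <;>
  rcases Nat.even_or_odd (i : ℕ) with hi' | hi' <;>
  simp [hi'.neg_one_pow]

/-- The operator `∂̄` on an open part of the vector space `E`: if `α` is a form of type `(p, q)`,
then `∂̄α = ∑ⱼ dz̄ⱼ ∧ ∂α/∂z̄ⱼ` is obtained from the conjugate-linear part of the derivative of `α` in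
the same way as the exterior derivative `extDeriv α` from the full derivative. -/
def dbarModel {k : ℕ} (α : E → Alt E F k) (y : E) : Alt E F (k + 1) :=
  ContinuousAlternatingMap.alternatizeUncurryFin (conjPart (fderiv ℝ α y))

theorem dbarModel_add {k : ℕ} {α α' : E → Alt E F k} {y : E}
    (h : DifferentiableAt ℝ α y) (h' : DifferentiableAt ℝ α' y) :
    dbarModel (α + α') y = dbarModel α y + dbarModel α' y := by
  rw [dbarModel, fderiv_add h h', conjPart_add,
    ContinuousAlternatingMap.alternatizeUncurryFin_add]
  rfl

theorem dbarModel_smul {k : ℕ} (c : ℂ) {α : E → Alt E F k} {y : E}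
    (h : DifferentiableAt ℝ α y) : dbarModel (c • α) y = c • dbarModel α y := by
  rw [dbarModel, fderiv_const_smul h c, conjPart_smul,
    ContinuousAlternatingMap.alternatizeUncurryFin_smul]
  rfl

end Linear

section Forms

variable (E F : Type*) [NormedAddCommGroup E] [NormedSpace ℂ E]
  [NormedAddCommGroup F] [NormedSpace ℂ F] {X : Type*} [TopologicalSpace X] [ChartedSpace E X]

/-- A differential `k`-form on `X` with values in `F`, without any regularity: a family of
alternating real `k`-linear maps on the tangent spaces. -/
abbrev PreForm (X : Type*) (k : ℕ) : Type _ := X → Alt E F k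

variable {E F}

/-- The expression of the form `α` in the chart `φ = chartAt E c`, that is, the pull-back of `α`
under `φ⁻¹`, a form on the open set `φ.target` of `E`.  The derivative of `φ⁻¹` at `y` is computed
in the preferred chart at the point `φ⁻¹ y`. -/
def inChart {k : ℕ} (c : X) (α : PreForm E F X k) : E → Alt E F k := fun y =>
  (α ((chartAt E c).symm y)).compContinuousLinearMap
    (fderiv ℝ (chartAt E ((chartAt E c).symm y) ∘ (chartAt E c).symm) y)

/-- The form `α` is `C^∞` at `x`: its expression in every chart around `x` is. -/
def SmoothAt {k : ℕ} (α : PreForm E F X k) (x : X) : Prop :=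
  ∀ c : X, x ∈ (chartAt E c).source → ContDiffAt ℝ ∞ (inChart c α) (chartAt E c x)

/-- The operator `∂̄`, computed at `x` in the preferred chart at `x`.  It is used only for smooth
forms of some type `(p, q)`, where the result does not depend on the chart. -/
def dbar {k : ℕ} (α : PreForm E F X k) : PreForm E F X (k + 1) := fun x =>
  dbarModel (inChart x α) (chartAt E x x)

/-- A function as a `0`-form. -/
def ofFun (E : Type*) [NormedAddCommGroup E] [NormedSpace ℂ E] {X : Type*} (f : X → ℂ) :
    PreForm E ℂ X 0 :=
  fun x => ContinuousAlternatingMap.constOfIsEmpty ℝ E (Fin 0) (f x)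

theorem inChart_add {k : ℕ} (c : X) (α α' : PreForm E F X k) :
    inChart c (α + α') = inChart c α + inChart c α' := rfl

theorem inChart_smul {k : ℕ} (c : X) (a : ℂ) (α : PreForm E F X k) :
    inChart c (a • α) = a • inChart c α := rfl

theorem inChart_zero {k : ℕ} (c : X) : inChart c (0 : PreForm E F X k) = 0 := rfl

theorem inChart_congr {k : ℕ} {α α' : PreForm E F X k} {x : X} (h : α =ᶠ[𝓝 x] α') (c : X)
    (hx : x ∈ (chartAt E c).source) :
    inChart c α =ᶠ[𝓝 (chartAt E c x)] inChart c α' := by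
  have hc := (chartAt E c).tendsto_symm hx
  filter_upwards [hc.eventually h] with y hy
  simp only [inChart, hy]

theorem SmoothAt.congr {k : ℕ} {α α' : PreForm E F X k} {x : X} (hα : SmoothAt α x)
    (h : α =ᶠ[𝓝 x] α') : SmoothAt α' x := fun c hc =>
  (hα c hc).congr_of_eventuallyEq (inChart_congr h c hc).symm

theorem smoothAt_zero {k : ℕ} (x : X) : SmoothAt (0 : PreForm E F X k) x := fun c _ => by
  rw [inChart_zero]
  exact contDiffAt_const

theorem SmoothAt.add {k : ℕ} {α α' : PreForm E F X k} {x : X} (hα : SmoothAt α x)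
    (hα' : SmoothAt α' x) : SmoothAt (α + α') x := fun c hc => (hα c hc).add (hα' c hc)

theorem SmoothAt.smul {k : ℕ} (a : ℂ) {α : PreForm E F X k} {x : X} (hα : SmoothAt α x) :
    SmoothAt (a • α) x := fun c hc => (hα c hc).const_smul a

theorem SmoothAt.differentiableAt {k : ℕ} {α : PreForm E F X k} {x : X} (hα : SmoothAt α x) :
    DifferentiableAt ℝ (inChart x α) (chartAt E x x) :=
  (hα x (mem_chart_source E x)).differentiableAt (by simp)

theorem dbar_congr {k : ℕ} {α α' : PreForm E F X k} {x : X} (h : α =ᶠ[𝓝 x] α') :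
    dbar α x = dbar α' x := by
  rw [dbar, dbar, dbarModel, dbarModel,
    (inChart_congr h x (mem_chart_source E x)).fderiv_eq]

theorem dbar_zero {k : ℕ} (x : X) : dbar (0 : PreForm E F X k) x = 0 := by
  have h : inChart x (0 : PreForm E F X k) = fun _ => 0 := rfl
  have h' : conjPart (0 : E →L[ℝ] Alt E F k) = 0 := by
    ext v
    simp [conjPart_apply]
  rw [dbar, h, dbarModel, fderiv_fun_const, Pi.zero_apply, h']
  exact (ContinuousAlternatingMap.alternatizeUncurryFinCLM ℝ E F).map_zero

theorem dbar_add {k : ℕ} {α α' : PreForm E F X k} {x : X} (hα : SmoothAt α x)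
    (hα' : SmoothAt α' x) : dbar (α + α') x = dbar α x + dbar α' x := by
  unfold dbar
  rw [inChart_add]
  exact dbarModel_add hα.differentiableAt hα'.differentiableAt

theorem dbar_smul {k : ℕ} (a : ℂ) {α : PreForm E F X k} {x : X} (hα : SmoothAt α x) :
    dbar (a • α) x = a • dbar α x := by
  unfold dbar
  rw [inChart_smul]
  exact dbarModel_smul a hα.differentiableAt

/-- Forms with arbitrary supports, or with compact supports. -/
inductive Supports
  | all
  | compact

variable (E F)

/-- The space of `C^∞` forms of type `(p, q)` on the open set `U` of `X`, with arbitrary supports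
or with compact supports.  A form on `U` is recorded by its extension by zero to the set `X`
(of which only the values on `U` matter: no regularity is required outside of `U`). -/
def forms (Φ : Supports) (p q : ℕ) (U : Opens X) : Submodule ℂ (PreForm E F X (p + q)) where
  carrier := {α | (∀ x ∉ U, α x = 0) ∧ (∀ x ∈ U, SmoothAt α x) ∧ (∀ x, IsType p q (α x)) ∧
    (Φ = .compact → ∃ C : Set X, IsCompact C ∧ C ⊆ U ∧ ∀ x ∉ C, α x = 0)}
  zero_mem' := ⟨fun _ _ => rfl, fun x _ => smoothAt_zero x, fun x c v => by simp,
    fun _ => ⟨∅, isCompact_empty, empty_subset _, fun _ _ => rfl⟩⟩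
  add_mem' := by
    rintro α α' ⟨h1, h2, h3, h4⟩ ⟨h1', h2', h3', h4'⟩
    refine ⟨fun x hx => by simp [h1 x hx, h1' x hx], fun x hx => (h2 x hx).add (h2' x hx),
      fun x c v => ?_, fun hΦ => ?_⟩
    · simp only [Pi.add_apply, ContinuousAlternatingMap.add_apply, h3 x c v, h3' x c v, smul_add]
    · obtain ⟨C, hC, hCU, hα⟩ := h4 hΦ
      obtain ⟨C', hC', hCU', hα'⟩ := h4' hΦ
      refine ⟨C ∪ C', hC.union hC', union_subset hCU hCU', fun x hx => ?_⟩
      rw [mem_union, not_or] at hx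
      simp [hα x hx.1, hα' x hx.2]
  smul_mem' := by
    rintro a α ⟨h1, h2, h3, h4⟩
    refine ⟨fun x hx => by simp [h1 x hx], fun x hx => (h2 x hx).smul a, fun x c v => ?_,
      fun hΦ => ?_⟩
    · simp only [Pi.smul_apply, ContinuousAlternatingMap.smul_apply, h3 x c v]
      rw [smul_comm]
    · obtain ⟨C, hC, hCU, hα⟩ := h4 hΦ
      exact ⟨C, hC, hCU, fun x hx => by simp [hα x hx]⟩

/-! ### Dolbeault cohomology -/

/-- The `∂̄`-closed forms of type `(p, q)` on `U`. -/
def cocycles (Φ : Supports) (p q : ℕ) (U : Opens X) : Submodule ℂ (PreForm E F X (p + q)) where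
  carrier := {α | α ∈ forms E F Φ p q U ∧ ∀ x ∈ U, dbar α x = 0}
  zero_mem' := ⟨zero_mem _, fun x _ => dbar_zero x⟩
  add_mem' := by
    rintro α α' ⟨h1, h2⟩ ⟨h1', h2'⟩
    refine ⟨add_mem h1 h1', fun x hx => ?_⟩
    rw [dbar_add (h1.2.1 x hx) (h1'.2.1 x hx), h2 x hx, h2' x hx, add_zero]
  smul_mem' := by
    rintro a α ⟨h1, h2⟩
    refine ⟨Submodule.smul_mem _ a h1, fun x hx => ?_⟩
    rw [dbar_smul a (h1.2.1 x hx), h2 x hx, smul_zero]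

/-- The `∂̄`-exact forms of type `(p, q)` on `U`: those that equal `∂̄θ` on `U` for some form `θ` of
type `(p, q - 1)` on `U` (with compact support in the case of compact supports); only `0` if
`q = 0`. -/
def coboundaries (Φ : Supports) (p : ℕ) :
    (q : ℕ) → (U : Opens X) → Submodule ℂ (PreForm E F X (p + q))
  | 0, _ => ⊥
  | q + 1, U =>
    { carrier := {α | ∃ θ ∈ forms E F Φ p q U, ∀ x ∈ U, α x = dbar θ x}
      zero_mem' := ⟨0, zero_mem _, fun x _ => (dbar_zero x).symm⟩
      add_mem' := by
        rintro α α' ⟨θ, hθ, h⟩ ⟨θ', hθ', h'⟩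
        refine ⟨θ + θ', add_mem hθ hθ', fun x hx => ?_⟩
        rw [dbar_add (hθ.2.1 x hx) (hθ'.2.1 x hx), ← h x hx, ← h' x hx]
        rfl
      smul_mem' := by
        rintro a α ⟨θ, hθ, h⟩
        refine ⟨a • θ, Submodule.smul_mem _ a hθ, fun x hx => ?_⟩
        rw [dbar_smul a (hθ.2.1 x hx), ← h x hx]
        rfl }

/-- The Dolbeault cohomology of type `(p, q)` of the open set `U`, with arbitrary supports or with
compact supports: closed forms modulo (closed) exact forms.  The usual scalar valued Dolbeault
cohomology is the case `F = ℂ`. -/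
abbrev Cohomology (Φ : Supports) (p q : ℕ) (U : Opens X) : Type _ :=
  cocycles E F Φ p q U ⧸ (coboundaries E F Φ p q U).comap (cocycles E F Φ p q U).subtype

/-- The cohomology class of a closed form. -/
abbrev cls (Φ : Supports) (p q : ℕ) (U : Opens X) :
    cocycles E F Φ p q U →ₗ[ℂ] Cohomology E F Φ p q U :=
  ((coboundaries E F Φ p q U).comap (cocycles E F Φ p q U).subtype).mkQ

/-! ### Restriction, extension by zero, and forgetting supports -/

open Classical in
/-- Restriction of a form to the open set `V`. -/
def restrict {k : ℕ} (V : Opens X) : PreForm E F X k →ₗ[ℂ] PreForm E F X k where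
  toFun α x := if x ∈ V then α x else 0
  map_add' α α' := by
    funext x
    by_cases h : x ∈ V <;> simp [h]
  map_smul' a α := by
    funext x
    by_cases h : x ∈ V <;> simp [h]

variable {E F}

theorem restrict_of_mem {k : ℕ} {V : Opens X} (α : PreForm E F X k) {x : X} (hx : x ∈ V) :
    restrict E F V α x = α x := by simp [restrict, hx]

theorem restrict_of_notMem {k : ℕ} {V : Opens X} (α : PreForm E F X k) {x : X} (hx : x ∉ V) :
    restrict E F V α x = 0 := by simp [restrict, hx]

theorem restrict_eventuallyEq {k : ℕ} {V : Opens X} (α : PreForm E F X k) {x : X} (hx : x ∈ V) :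
    α =ᶠ[𝓝 x] restrict E F V α := by
  filter_upwards [V.isOpen.mem_nhds hx] with y hy
  exact (restrict_of_mem α hy).symm

theorem restrict_mem_forms {p q : ℕ} {U V : Opens X} (h : V ≤ U) {α : PreForm E F X (p + q)}
    (hα : α ∈ forms E F .all p q U) : restrict E F V α ∈ forms E F .all p q V := by
  obtain ⟨-, h2, h3, -⟩ := hα
  refine ⟨fun x hx => restrict_of_notMem α hx,
    fun x hx => (h2 x (h hx)).congr (restrict_eventuallyEq α hx), fun x => ?_, nofun⟩
  by_cases hx : x ∈ V
  · rw [restrict_of_mem α hx]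
    exact h3 x
  · rw [restrict_of_notMem α hx]
    intro c v
    simp

theorem restrict_mem_cocycles {p q : ℕ} {U V : Opens X} (h : V ≤ U) {α : PreForm E F X (p + q)}
    (hα : α ∈ cocycles E F .all p q U) : restrict E F V α ∈ cocycles E F .all p q V :=
  ⟨restrict_mem_forms h hα.1, fun x hx => by
    rw [← dbar_congr (restrict_eventuallyEq α hx), hα.2 x (h hx)]⟩

theorem restrict_mem_coboundaries {p q : ℕ} {U V : Opens X} (h : V ≤ U) {α : PreForm E F X (p + q)}
    (hα : α ∈ coboundaries E F .all p q U) : restrict E F V α ∈ coboundaries E F .all p q V := by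
  cases q with
  | zero =>
    change α = 0 at hα
    rw [hα, map_zero]
    exact zero_mem _
  | succ q =>
    obtain ⟨θ, hθ, hαθ⟩ := hα
    refine ⟨restrict E F V θ, restrict_mem_forms h hθ, fun x hx => ?_⟩
    rw [← dbar_congr (restrict_eventuallyEq θ hx), ← hαθ x (h hx)]
    exact restrict_of_mem α hx

theorem extend_mem_forms [T2Space X] {p q : ℕ} {U V : Opens X} (h : U ≤ V)
    {α : PreForm E F X (p + q)} (hα : α ∈ forms E F .compact p q U) :
    α ∈ forms E F .compact p q V := by
  obtain ⟨h1, h2, h3, h4⟩ := hα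
  obtain ⟨C, hC, hCU, hCα⟩ := h4 rfl
  refine ⟨fun x hx => h1 x fun hxU => hx (h hxU), fun x _ => ?_, h3,
    fun _ => ⟨C, hC, hCU.trans h, hCα⟩⟩
  by_cases hxU : x ∈ U
  · exact h2 x hxU
  · refine (smoothAt_zero x).congr ?_
    filter_upwards [hC.isClosed.isOpen_compl.mem_nhds fun hxC => hxU (hCU hxC)] with y hy
    exact (hCα y hy).symm

theorem dbar_eq_zero_of_notMem [T2Space X] {p q : ℕ} {U : Opens X}
    {α : PreForm E F X (p + q)} (hα : α ∈ forms E F .compact p q U) {x : X} (hx : x ∉ U) :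
    dbar α x = 0 := by
  obtain ⟨C, hC, hCU, hCα⟩ := hα.2.2.2 rfl
  rw [← dbar_zero (E := E) (k := p + q) x]
  refine dbar_congr ?_
  filter_upwards [hC.isClosed.isOpen_compl.mem_nhds fun hxC => hx (hCU hxC)] with y hy
  exact hCα y hy

theorem extend_mem_cocycles [T2Space X] {p q : ℕ} {U V : Opens X} (h : U ≤ V)
    {α : PreForm E F X (p + q)} (hα : α ∈ cocycles E F .compact p q U) :
    α ∈ cocycles E F .compact p q V := by
  refine ⟨extend_mem_forms h hα.1, fun x _ => ?_⟩
  by_cases hxU : x ∈ U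
  · exact hα.2 x hxU
  · exact dbar_eq_zero_of_notMem hα.1 hxU

theorem extend_mem_coboundaries [T2Space X] {p q : ℕ} {U V : Opens X} (h : U ≤ V)
    {α : PreForm E F X (p + q)} (hα : α ∈ cocycles E F .compact p q U)
    (hα' : α ∈ coboundaries E F .compact p q U) : α ∈ coboundaries E F .compact p q V := by
  cases q with
  | zero => exact hα'
  | succ q =>
    obtain ⟨θ, hθ, hαθ⟩ := hα'
    refine ⟨θ, extend_mem_forms h hθ, fun x _ => ?_⟩
    by_cases hxU : x ∈ U
    · exact hαθ x hxU
    · rw [dbar_eq_zero_of_notMem hθ hxU]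
      exact hα.1.1 x hxU

theorem forget_mem_forms {p q : ℕ} {U : Opens X} {α : PreForm E F X (p + q)}
    (hα : α ∈ forms E F .compact p q U) : α ∈ forms E F .all p q U :=
  ⟨hα.1, hα.2.1, hα.2.2.1, nofun⟩

theorem forget_mem_cocycles {p q : ℕ} {U : Opens X} {α : PreForm E F X (p + q)}
    (hα : α ∈ cocycles E F .compact p q U) : α ∈ cocycles E F .all p q U :=
  ⟨forget_mem_forms hα.1, hα.2⟩

theorem forget_mem_coboundaries {p q : ℕ} {U : Opens X} {α : PreForm E F X (p + q)}
    (hα : α ∈ coboundaries E F .compact p q U) : α ∈ coboundaries E F .all p q U := by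
  cases q with
  | zero => exact hα
  | succ q =>
    obtain ⟨θ, hθ, hαθ⟩ := hα
    exact ⟨θ, forget_mem_forms hθ, hαθ⟩

variable (E F)

/-- The restriction `H^{p,q}(U) → H^{p,q}(V)` for open sets `V ⊆ U`. -/
def resMap (p q : ℕ) {U V : Opens X} (h : V ≤ U) :
    Cohomology E F .all p q U →ₗ[ℂ] Cohomology E F .all p q V :=
  Submodule.mapQ _ _ ((restrict E F V).restrict fun _ hα => restrict_mem_cocycles h hα)
    fun _ hα => restrict_mem_coboundaries h hα

/-- The map `H_c^{p,q}(U) → H_c^{p,q}(V)` for open sets `U ⊆ V`, induced by extension by zero of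
compactly supported forms. -/
def extMap [T2Space X] (p q : ℕ) {U V : Opens X} (h : U ≤ V) :
    Cohomology E F .compact p q U →ₗ[ℂ] Cohomology E F .compact p q V :=
  Submodule.mapQ _ _ (Submodule.inclusion fun _ hα => extend_mem_cocycles h hα)
    fun α hα => extend_mem_coboundaries h α.2 hα

/-- The map `H_c^{p,q}(U) → H^{p,q}(U)` induced by the inclusion of the compactly supported forms
into all forms. -/
def forgetMap (p q : ℕ) (U : Opens X) :
    Cohomology E F .compact p q U →ₗ[ℂ] Cohomology E F .all p q U :=
  Submodule.mapQ _ _ (Submodule.inclusion fun _ hα => forget_mem_cocycles hα)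
    fun _ hα => forget_mem_coboundaries hα

/-! ### Cohomology along a compact set, and the maps of the sequence -/

/-- The open neighbourhoods of `K`. -/
abbrev OpenNhd (K : Compacts X) : Type _ := {V : Opens X // (K : Set X) ⊆ V}

/-- The whole space as a neighbourhood of `K`. -/
def OpenNhd.top (K : Compacts X) : OpenNhd K := ⟨⊤, subset_univ _⟩

/-- The complement of `K` as an open set. -/
def complement [T2Space X] (K : Compacts X) : Opens X :=
  ⟨(K : Set X)ᶜ, K.isCompact.isClosed.isOpen_compl⟩

open Classical in
/-- The space `H^{p,q}[K]`: the direct limit of `H^{p,q}(V)`, where `V` runs through the open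
neighbourhoods of `K`, ordered by reverse inclusion. -/
abbrev GermCohomology (p q : ℕ) (K : Compacts X) : Type _ :=
  Module.DirectLimit (R := ℂ) (ι := (OpenNhd K)ᵒᵈ)
    (fun V => Cohomology E F .all p q (OrderDual.ofDual V).1)
    (fun _ _ h => resMap E F p q (OrderDual.ofDual_le_ofDual.2 h))

open Classical in
/-- The canonical map `H^{p,q}(V) → H^{p,q}[K]` for an open neighbourhood `V` of `K`. -/
def toGerm (p q : ℕ) {K : Compacts X} (V : OpenNhd K) :
    Cohomology E F .all p q V.1 →ₗ[ℂ] GermCohomology E F p q K :=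
  Module.DirectLimit.of ℂ (OpenNhd K)ᵒᵈ
    (fun V => Cohomology E F .all p q (OrderDual.ofDual V).1)
    (fun _ _ h => resMap E F p q (OrderDual.ofDual_le_ofDual.2 h)) (OrderDual.toDual V)

/-- The map `i^* : H_c^{p,q}(X ∖ K) → H_c^{p,q}(X)`, extension by zero. -/
def iStar [T2Space X] (p q : ℕ) (K : Compacts X) :
    Cohomology E F .compact p q (complement K) →ₗ[ℂ] Cohomology E F .compact p q (⊤ : Opens X) :=
  extMap E F p q le_top

/-- The map `j^* : H_c^{p,q}(X) → H^{p,q}(X) → H^{p,q}[K]`. -/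
def jStar (p q : ℕ) (K : Compacts X) :
    Cohomology E F .compact p q (⊤ : Opens X) →ₗ[ℂ] GermCohomology E F p q K :=
  (toGerm E F p q (OpenNhd.top K)).comp (forgetMap E F p q ⊤)

/-- `γ : H^{p,q}[K] → H_c^{p,q+1}(X ∖ K)` is given by `γ [η] = [η ∧ ∂̄ρ₁]`, for every closed form `η`
on a relatively compact open neighbourhood `V` of `K` and every `C^∞` partition of unity `{ρ₀, ρ₁}`
subordinate to the covering `{X ∖ K, V}` of `X`.  That `η ∧ ∂̄ρ₁` (which is `0` outside of `V`) is a
closed form with compact support in `X ∖ K` is a part of the claim. -/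
def IsConnectingMap [T2Space X] (p q : ℕ) (K : Compacts X)
    (γ : GermCohomology E F p q K →ₗ[ℂ] Cohomology E F .compact p (q + 1) (complement K)) : Prop :=
  ∀ (V : OpenNhd K), IsCompact (closure (V.1 : Set X)) →
  ∀ (η : cocycles E F .all p q V.1) (ρ : SmoothPartitionOfUnity (Fin 2) 𝓘(ℝ, E) X univ),
    ρ.IsSubordinate ![(K : Set X)ᶜ, (V.1 : Set X)] →
    ∃ α : cocycles E F .compact p (q + 1) (complement K),
      (∀ x, α.1 x = wedgeOne (η.1 x) (dbar (ofFun E fun y => (ρ 1 y : ℂ)) x)) ∧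
      γ (toGerm E F p q V (cls E F .all p q V.1 η)) = cls E F .compact p (q + 1) (complement K) α

end Forms

end Dolbeault

end

/-! A form with compact support in `X ∖ K` is a compactly supported form on `X` that vanishes near
`K`, and every form near `K` agrees, closer to `K`, with a compactly supported form on `X`: multiply
it by a cutoff function `χ`. So compactly supported forms on `X ∖ K`, those on `X`, and germs of
forms along `K` make a short exact sequence of `∂̄`-complexes, and the theorem is its long exact
sequence. The snake construction lifts a closed germ `η` to `χη` and applies `∂̄`; by the Leibniz
rule `η ∧ ∂̄χ = (-1)^(p+q) ∂̄(χη)`, which is the prescribed formula.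

The diagram chase is done with forms. Its engine is `exists_forms_complement`: if `θ` has compact
support and `θ = ∂̄ζ` near `K`, then `θ - ∂̄(χζ)` vanishes near `K`. This gives exactness at
`H_c(X)` and, through `cls_wedgeCutoff_eq`, the independence of `[η ∧ ∂̄χ]` from all choices; the
other exactness claims then follow by exhibiting primitives.

Beforehand `∂̄` has to be shown independent of charts (`inChart_dbar`), with square zero
(`dbar_dbar`) and a Leibniz rule (`wedgeOne_dbar_ofFun`). Chart independence is deduced from that of
`d` by comparing types. `IsBitype` leaves the degree `k` free because `m + 1 + n` and `m + n + 1`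
are not definitionally equal. -/

noncomputable section

namespace Dolbeault

/-! ### Types of forms and the operator `∂̄` on a complex vector space. -/

section Model

variable {E F : Type*} [NormedAddCommGroup E] [NormedSpace ℂ E]
  [NormedAddCommGroup F] [NormedSpace ℂ F]

/-- The alternating `k`-form `α` transforms under multiplication of all arguments by a complex
number `c` with the factor `c ^ m * conj c ^ n`. -/
def IsBitype (m n : ℕ) {k : ℕ} (α : Alt E F k) : Prop :=
  ∀ (c : ℂ) (v : Fin k → E), α (fun i => c • v i) = (c ^ m * (starRingEnd ℂ) c ^ n) • α v

theorem real_map_complex_smul (L : E →L[ℝ] F) (c : ℂ) (v : E) :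
    L (c • v) = (c.re : ℂ) • L v + (c.im : ℂ) • L (Complex.I • v) := by
  have h : c • v = c.re • v + c.im • (Complex.I • v) := by
    conv_lhs => rw [← Complex.re_add_im c]
    rw [add_smul, mul_smul, Complex.coe_smul, Complex.coe_smul]
  rw [h, map_add, map_smul, map_smul, Complex.coe_smul, Complex.coe_smul]

/-- With `sub_conjPart_apply_smul` this splits a real linear map into conjugate-linear and
complex-linear parts; the first raises the type by `(0, 1)`, the second by `(1, 0)`. -/
theorem conjPart_apply_smul (L : E →L[ℝ] F) (c : ℂ) (v : E) :
    conjPart L (c • v) = (starRingEnd ℂ) c • conjPart L v := by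
  have hI : Complex.I • Complex.I • v = -v := by rw [smul_smul, Complex.I_mul_I, neg_one_smul]
  have hc : (starRingEnd ℂ) c = c.re - c.im * Complex.I := by
    apply Complex.ext <;> simp
  rw [conjPart_apply, conjPart_apply, smul_comm Complex.I c v, real_map_complex_smul L c v,
    real_map_complex_smul L c (Complex.I • v), hI, map_neg, hc]
  match_scalars <;> ring_nf <;> simp only [Complex.I_sq] <;> ring

theorem sub_conjPart_apply_smul (L : E →L[ℝ] F) (c : ℂ) (v : E) :
    (L - conjPart L) (c • v) = c • (L - conjPart L) v := by
  have hc : (starRingEnd ℂ) c = c.re - c.im * Complex.I := by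
    apply Complex.ext <;> simp
  rw [_root_.sub_apply, _root_.sub_apply, conjPart_apply_smul,
    conjPart_apply, real_map_complex_smul L c v, hc]
  conv_rhs => rw [← Complex.re_add_im c]
  match_scalars <;> ring_nf <;> simp only [Complex.I_sq] <;> ring

/-- In each term of the alternatization one vector enters through `L`, giving the factor of `(m',
n')`, and the others enter through a form of type `(m, n)`. -/
theorem IsBitype.alternatize {m n m' n' k : ℕ} {L : E →L[ℝ] Alt E F k}
    (hL : ∀ w, IsBitype m n (L w))
    (h : ∀ (c : ℂ) (w : E), L (c • w) = (c ^ m' * (starRingEnd ℂ) c ^ n') • L w) :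
    IsBitype (m + m') (n + n') (ContinuousAlternatingMap.alternatizeUncurryFin L) := by
  intro c v
  rw [ContinuousAlternatingMap.alternatizeUncurryFin_apply,
    ContinuousAlternatingMap.alternatizeUncurryFin_apply, Finset.smul_sum]
  refine Finset.sum_congr rfl fun i _ => ?_
  have h1 : i.removeNth (fun j => c • v j) = fun j => c • (i.removeNth v) j := rfl
  rw [h c (v i), h1, ContinuousAlternatingMap.smul_apply, hL (v i) c, smul_comm _ ((-1 : ℤ) ^ _),
    smul_smul]
  congr 2
  ring

theorem IsBitype.sub {m n k : ℕ} {α β : Alt E F k} (hα : IsBitype m n α) (hβ : IsBitype m n β) :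
    IsBitype m n (α - β) := fun c v => by
  rw [ContinuousAlternatingMap.sub_apply, ContinuousAlternatingMap.sub_apply, hα c, hβ c, smul_sub]

theorem IsBitype.smul {m n k : ℕ} {α : Alt E F k} (hα : IsBitype m n α) (a : ℂ) :
    IsBitype m n (a • α) := fun c v => by
  rw [ContinuousAlternatingMap.smul_apply, ContinuousAlternatingMap.smul_apply, hα c, smul_comm]

theorem IsBitype.add {m n k : ℕ} {α β : Alt E F k} (hα : IsBitype m n α) (hβ : IsBitype m n β) :
    IsBitype m n (α + β) := fun c v => by
  rw [ContinuousAlternatingMap.add_apply, ContinuousAlternatingMap.add_apply, hα c, hβ c, smul_add]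

/-- Pull-back by a complex linear map preserves the type. -/
theorem IsBitype.compContinuousLinearMap {m n k : ℕ} {α : Alt E F k} (hα : IsBitype m n α)
    {T : E →L[ℝ] E} (hT : ∀ (c : ℂ) v, T (c • v) = c • T v) :
    IsBitype m n (α.compContinuousLinearMap T) := fun c v => by
  have h := hα c (T ∘ v)
  simp only [ContinuousAlternatingMap.compContinuousLinearMap_apply]
  rw [← h]
  congr 1
  funext i
  exact hT c (v i)

/-- A form of two neighbouring types vanishes. -/
theorem IsBitype.eq_zero {p q k : ℕ} {α : Alt E F k} (h : IsBitype p (q + 1) α)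
    (h' : IsBitype (p + 1) q α) : α = 0 := by
  ext v
  -- At `c = i` the two factors differ only by a sign, and neither is zero.
  have h1 := (h Complex.I v).symm.trans (h' Complex.I v)
  rw [← sub_eq_zero, ← sub_smul, smul_eq_zero] at h1
  refine h1.resolve_left fun h2 => ?_
  rw [pow_succ, pow_succ, Complex.conj_I] at h2
  have h3 : (Complex.I ^ p * (-Complex.I) ^ q) * (-2 * Complex.I) = 0 := by
    linear_combination h2
  simp at h3

/-- The derivative of a family of forms of a fixed type has the same type. -/
theorem isBitype_fderiv {m n k : ℕ} {α : E → Alt E F k} {y : E} (hd : DifferentiableAt ℝ α y)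
    (h : ∀ᶠ z in 𝓝 y, IsBitype m n (α z)) (w : E) : IsBitype m n (fderiv ℝ α y w) := by
  intro c v
  -- `P` is pull-back by multiplication by `c`. The type condition near `y` reads `P ∘ α = const •
  -- α`, and differentiating this identity gives the claim.
  let P : Alt E F k →L[ℝ] Alt E F k :=
    ContinuousAlternatingMap.compContinuousLinearMapCLM (c • ContinuousLinearMap.id ℝ E)
  have h1 : (fun z => P (α z)) =ᶠ[𝓝 y]
      fun z => (c ^ m * (starRingEnd ℂ) c ^ n) • α z := by
    filter_upwards [h] with z hz
    ext u
    exact hz c u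
  have h2 := h1.fderiv_eq (𝕜 := ℝ)
  have h3 : HasFDerivAt (fun z => P (α z)) _ y := P.hasFDerivAt.comp y hd.hasFDerivAt
  rw [h3.fderiv, (hd.hasFDerivAt.fun_const_smul (c ^ m * (starRingEnd ℂ) c ^ n)).fderiv] at h2
  exact congrArg (fun L : E →L[ℝ] Alt E F k => L w v) h2

theorem isBitype_conjPart {m n k : ℕ} {L : E →L[ℝ] Alt E F k} (hL : ∀ w, IsBitype m n (L w))
    (w : E) : IsBitype m n (conjPart L w) := by
  rw [conjPart_apply]
  exact ((hL _).add ((hL _).smul _)).smul _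

theorem isBitype_dbarModel {m n k : ℕ} {α : E → Alt E F k} {y : E} (hd : DifferentiableAt ℝ α y)
    (h : ∀ᶠ z in 𝓝 y, IsBitype m n (α z)) : IsBitype m (n + 1) (dbarModel α y) := by
  refine IsBitype.alternatize (m' := 0) (isBitype_conjPart (isBitype_fderiv hd h)) fun c w => ?_
  rw [conjPart_apply_smul]
  simp

/-- The exterior derivative of a form of type `(m, n)` is `∂̄` plus a form of type `(m + 1, n)`. -/
theorem isBitype_extDeriv_sub_dbarModel {m n k : ℕ} {α : E → Alt E F k} {y : E}
    (hd : DifferentiableAt ℝ α y) (h : ∀ᶠ z in 𝓝 y, IsBitype m n (α z)) :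
    IsBitype (m + 1) n (extDeriv α y - dbarModel α y) := by
  have h1 : extDeriv α y - dbarModel α y = ContinuousAlternatingMap.alternatizeUncurryFin
      (fderiv ℝ α y - conjPart (fderiv ℝ α y)) :=
    (map_sub (ContinuousAlternatingMap.alternatizeUncurryFinCLM ℝ E F) _ _).symm
  rw [h1]
  refine IsBitype.alternatize (n' := 0)
    (fun w => (isBitype_fderiv hd h w).sub (isBitype_conjPart (isBitype_fderiv hd h) w))
    fun c w => ?_
  rw [sub_conjPart_apply_smul]
  simp

/-- `∂̄` commutes with the pull-back by a holomorphic map on forms of a fixed type. -/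
theorem dbarModel_pullback {m n k : ℕ} {α : E → Alt E F k} {f : E → E} {y : E}
    (hα : DifferentiableAt ℝ α (f y)) (hf : ContDiffAt ℝ 2 f y)
    (hlin : ∀ᶠ z in 𝓝 y, ∀ (c : ℂ) v, fderiv ℝ f z (c • v) = c • fderiv ℝ f z v)
    (h : ∀ᶠ z in 𝓝 (f y), IsBitype m n (α z)) :
    dbarModel (fun z => (α (f z)).compContinuousLinearMap (fderiv ℝ f z)) y =
      (dbarModel α (f y)).compContinuousLinearMap (fderiv ℝ f y) := by
  have hfd : DifferentiableAt ℝ f y := hf.differentiableAt (by simp)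
  have hpull : DifferentiableAt ℝ
      (fun z => (α (f z)).compContinuousLinearMap (fderiv ℝ f z)) y :=
    (hα.comp y hfd).continuousAlternatingMapCompContinuousLinearMap
      ((hf.fderiv_right (m := 1) le_rfl).differentiableAt one_ne_zero)
  have htype : ∀ᶠ z in 𝓝 y,
      IsBitype m n ((α (f z)).compContinuousLinearMap (fderiv ℝ f z)) := by
    filter_upwards [hlin, hfd.continuousAt.eventually h] with z hz hz'
    exact hz'.compContinuousLinearMap hz
  have hd := extDeriv_pullback hα hf (by simp)
  have hlin' := hlin.self_of_nhds
  rw [← sub_eq_zero]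
  -- The defect of `∂̄` has type `(m, n + 1)`. As `d` commutes with pull-back, it is also minus the
  -- defect of `d - ∂̄`, which has type `(m + 1, n)`.
  refine IsBitype.eq_zero (p := m) (q := n) ((isBitype_dbarModel hpull htype).sub
    ((isBitype_dbarModel hα h).compContinuousLinearMap hlin')) ?_
  have h1 := ((isBitype_extDeriv_sub_dbarModel hα h).compContinuousLinearMap hlin').sub
    (isBitype_extDeriv_sub_dbarModel hpull htype)
  rw [hd] at h1
  convert h1 using 1
  ext v
  simp

/-- `conjPart` as a continuous linear map. -/
def conjPartCLM (E F : Type*) [NormedAddCommGroup E] [NormedSpace ℂ E]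
    [NormedAddCommGroup F] [NormedSpace ℂ F] : (E →L[ℝ] F) →L[ℝ] (E →L[ℝ] F) :=
  (2⁻¹ : ℂ) • (ContinuousLinearMap.id ℝ (E →L[ℝ] F) +
    Complex.I • (ContinuousLinearMap.compL ℝ E E F).flip (mulI E))

theorem conjPartCLM_apply (L : E →L[ℝ] F) : conjPartCLM E F L = conjPart L := rfl

theorem contDiffAt_dbarModel {k : ℕ} {α : E → Alt E F k} {y : E} (h : ContDiffAt ℝ ∞ α y) :
    ContDiffAt ℝ ∞ (dbarModel α) y :=
  ((ContinuousAlternatingMap.alternatizeUncurryFinCLM ℝ E F).comp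
    (conjPartCLM E (Alt E F k))).contDiff.contDiffAt.comp y (h.fderiv_right (m := ∞) (by simp))

/-- The second real derivative is symmetric, and taking conjugate-linear parts in both arguments
keeps it so; alternatizing a symmetric expression twice gives zero. -/
theorem dbarModel_dbarModel {k : ℕ} {α : E → Alt E F k} {y : E} (h : ContDiffAt ℝ ∞ α y) :
    dbarModel (dbarModel α) y = 0 := by
  have h1 : DifferentiableAt ℝ (fderiv ℝ α) y :=
    (h.fderiv_right (m := ∞) (by simp)).differentiableAt (by simp)
  have hsymm : ∀ v w, fderiv ℝ (fderiv ℝ α) y v w = fderiv ℝ (fderiv ℝ α) y w v :=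
    h.isSymmSndFDerivAt (by simpa using ENat.LEInfty.out)
  set A := ContinuousAlternatingMap.alternatizeUncurryFinCLM (n := k) ℝ E F
  set D := fderiv ℝ (fderiv ℝ α) y
  have h2 : HasFDerivAt (dbarModel α) ((A.comp (conjPartCLM E (Alt E F k))).comp D) y :=
    (A.comp (conjPartCLM E (Alt E F k))).hasFDerivAt.comp y h1.hasFDerivAt
  -- Alternatization is complex linear, so it commutes with taking the conjugate-linear part.
  have h3 : conjPart ((A.comp (conjPartCLM E (Alt E F k))).comp D) =
      A.comp (conjPart ((conjPartCLM E (Alt E F k)).comp D)) := by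
    have hA : ∀ (c : ℂ) x, A (c • x) = c • A x := fun c x =>
      ContinuousAlternatingMap.alternatizeUncurryFin_smul c x
    ext1 v
    simp only [conjPart_apply, ContinuousLinearMap.comp_apply, hA, map_add]
  rw [dbarModel, h2.fderiv, h3]
  refine ContinuousAlternatingMap.alternatizeUncurryFin_alternatizeUncurryFinCLM_comp_of_symmetric
    fun v w => ?_
  simp only [conjPart_apply, ContinuousLinearMap.comp_apply, conjPartCLM_apply,
    _root_.smul_apply, _root_.add_apply]
  rw [hsymm v w, hsymm (Complex.I • v) w, hsymm v (Complex.I • w),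
    hsymm (Complex.I • v) (Complex.I • w)]
  module

/-- The Leibniz rule for the product of a function and a form. -/
theorem dbarModel_smul_fun {k : ℕ} {g : E → ℂ} {α : E → Alt E F k} {y : E}
    (hg : DifferentiableAt ℝ g y) (hα : DifferentiableAt ℝ α y) :
    dbarModel (fun z => g z • α z) y = g y • dbarModel α y +
      ContinuousAlternatingMap.alternatizeUncurryFin
        ((conjPart (fderiv ℝ g y)).smulRight (α y)) := by
  have h : conjPart (fderiv ℝ (fun z => g z • α z) y) = g y • conjPart (fderiv ℝ α y) +
      (conjPart (fderiv ℝ g y)).smulRight (α y) := by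
    rw [fderiv_fun_smul hg hα]
    ext1 v
    simp only [conjPart_apply, _root_.add_apply, _root_.smul_apply,
      ContinuousLinearMap.smulRight_apply, smul_eq_mul]
    module
  rw [dbarModel, h, ContinuousAlternatingMap.alternatizeUncurryFin_add,
    ContinuousAlternatingMap.alternatizeUncurryFin_smul]
  rfl

end Model

section Product

variable {E F X : Type*} [NormedAddCommGroup E] [NormedSpace ℂ E]
  [NormedAddCommGroup F] [NormedSpace ℂ F]

/-- The product of a function and a form. -/
def mulForm {k : ℕ} (f : X → ℂ) : PreForm E F X k →ₗ[ℂ] PreForm E F X k where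
  toFun α x := f x • α x
  map_add' _ _ := funext fun _ => smul_add _ _ _
  map_smul' a α := funext fun x => smul_comm (f x) a (α x)

theorem mulForm_apply {k : ℕ} (f : X → ℂ) (α : PreForm E F X k) (x : X) :
    mulForm f α x = f x • α x := rfl

end Product

/-! ### Chart independence of `∂̄`, its square, and the Leibniz rule on `X`. -/

section Charts

variable {E F : Type*} [NormedAddCommGroup E] [NormedSpace ℂ E]
  [NormedAddCommGroup F] [NormedSpace ℂ F] {X : Type*} [TopologicalSpace X] [ChartedSpace E X]

theorem contDiffOn_transition [IsManifold 𝓘(ℂ, E) ω X] {e e' : OpenPartialHomeomorph X E}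
    (he : e ∈ atlas E X) (he' : e' ∈ atlas E X) :
    ContDiffOn ℂ ω (e' ∘ e.symm) (e.symm ≫ₕ e').source := by
  have h := (contDiffGroupoid ω 𝓘(ℂ, E)).compatible he he'
  rw [contDiffGroupoid, mem_groupoid_of_pregroupoid] at h
  simpa [contDiffPregroupoid] using h.1

-- The partitions of unity are real `C^∞`, so the underlying real manifold structure is needed.
variable (E X) in
theorem isManifold_real [IsManifold 𝓘(ℂ, E) ω X] : IsManifold 𝓘(ℝ, E) ∞ X :=
  isManifold_of_contDiffOn _ _ _ fun e e' he he' => by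
    have h := ((contDiffOn_transition he he').restrict_scalars ℝ).of_le (m := ∞) le_top
    simpa using h

theorem contDiffAt_transition [IsManifold 𝓘(ℂ, E) ω X] {a b : X} {y : E}
    (hy : y ∈ (chartAt E a).target) (hb : (chartAt E a).symm y ∈ (chartAt E b).source) :
    ContDiffAt ℂ ω (chartAt E b ∘ (chartAt E a).symm) y := by
  have hy' : y ∈ ((chartAt E a).symm ≫ₕ chartAt E b).source := by
    simpa [OpenPartialHomeomorph.trans_source] using ⟨hy, hb⟩
  exact (contDiffOn_transition (chart_mem_atlas E a) (chart_mem_atlas E b)).contDiffAt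
    (((chartAt E a).symm ≫ₕ chartAt E b).open_source.mem_nhds hy')

theorem contDiffAt_transition_real [IsManifold 𝓘(ℂ, E) ω X] {a b : X} {y : E}
    (hy : y ∈ (chartAt E a).target) (hb : (chartAt E a).symm y ∈ (chartAt E b).source) :
    ContDiffAt ℝ ω (chartAt E b ∘ (chartAt E a).symm) y :=
  (contDiffAt_transition hy hb).restrict_scalars ℝ

theorem fderiv_transition_smul [IsManifold 𝓘(ℂ, E) ω X] {a b : X} {y : E}
    (hy : y ∈ (chartAt E a).target) (hb : (chartAt E a).symm y ∈ (chartAt E b).source)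
    (c : ℂ) (v : E) :
    fderiv ℝ (chartAt E b ∘ (chartAt E a).symm) y (c • v) =
      c • fderiv ℝ (chartAt E b ∘ (chartAt E a).symm) y v := by
  rw [((contDiffAt_transition hy hb).differentiableAt (by simp)).fderiv_restrictScalars ℝ]
  simp

/-- The preferred chart in `inChart` varies with `y`; naming the base point `w` makes rewriting
possible. -/
theorem inChart_apply {k : ℕ} {c w : X} {y : E} (h : (chartAt E c).symm y = w)
    (α : PreForm E F X k) :
    inChart c α y = (α w).compContinuousLinearMap
      (fderiv ℝ (chartAt E w ∘ (chartAt E c).symm) y) := by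
  subst h
  rfl

theorem inChart_self {k : ℕ} (x : X) (α : PreForm E F X k) :
    inChart x α (chartAt E x x) = α x := by
  have h : (chartAt E x ∘ (chartAt E x).symm) =ᶠ[𝓝 (chartAt E x x)] id :=
    (chartAt E x).eventually_right_inverse' (mem_chart_source E x)
  rw [inChart_apply ((chartAt E x).left_inv (mem_chart_source E x)), h.fderiv_eq, fderiv_id]
  rfl

/-- The expressions of a form in two charts are related by the pull-back by the change of
charts. -/
theorem inChart_eq_pullback [IsManifold 𝓘(ℂ, E) ω X] {k : ℕ} {c z : X} {y : E}
    (hy : y ∈ (chartAt E c).target) (hz : (chartAt E c).symm y ∈ (chartAt E z).source)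
    (α : PreForm E F X k) :
    inChart c α y = (inChart z α ((chartAt E z ∘ (chartAt E c).symm) y)).compContinuousLinearMap
      (fderiv ℝ (chartAt E z ∘ (chartAt E c).symm) y) := by
  set w := (chartAt E c).symm y with hw
  have hw' : (chartAt E z).symm ((chartAt E z ∘ (chartAt E c).symm) y) = w :=
    (chartAt E z).left_inv hz
  have hmem : (chartAt E z ∘ (chartAt E c).symm) y ∈ (chartAt E z).target :=
    (chartAt E z).map_source hz
  have hcont : ContinuousAt (chartAt E c).symm y := (chartAt E c).continuousAt_symm hy
  have h : (chartAt E w ∘ (chartAt E c).symm) =ᶠ[𝓝 y]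
      (chartAt E w ∘ (chartAt E z).symm) ∘ (chartAt E z ∘ (chartAt E c).symm) := by
    filter_upwards [hcont.eventually ((chartAt E z).open_source.mem_nhds hz)] with u hu
    exact congrArg (chartAt E w) ((chartAt E z).left_inv hu).symm
  rw [inChart_apply hw.symm, inChart_apply hw', h.fderiv_eq, fderiv_comp]
  · rfl
  · exact (contDiffAt_transition_real hmem (by rw [hw']; exact mem_chart_source E w)).differentiableAt
      (by simp)
  · exact (contDiffAt_transition_real hy hz).differentiableAt (by simp)

theorem isBitype_inChart [IsManifold 𝓘(ℂ, E) ω X] {m n k : ℕ} {α : PreForm E F X k}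
    (h : ∀ x, IsBitype m n (α x)) (c : X) {y : E} (hy : y ∈ (chartAt E c).target) :
    IsBitype m n (inChart c α y) :=
  (h _).compContinuousLinearMap
    (fderiv_transition_smul hy (mem_chart_source E _))

theorem eventually_isBitype_inChart [IsManifold 𝓘(ℂ, E) ω X] {m n k : ℕ} {α : PreForm E F X k}
    (h : ∀ x, IsBitype m n (α x)) (c : X) {y : E} (hy : y ∈ (chartAt E c).target) :
    ∀ᶠ z in 𝓝 y, IsBitype m n (inChart c α z) := by
  filter_upwards [(chartAt E c).open_target.mem_nhds hy] with z hz
  exact isBitype_inChart h c hz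

theorem isBitype_dbar [IsManifold 𝓘(ℂ, E) ω X] {m n k : ℕ} {α : PreForm E F X k}
    (h : ∀ x, IsBitype m n (α x)) {x : X} (hx : SmoothAt α x) :
    IsBitype m (n + 1) (dbar α x) :=
  isBitype_dbarModel hx.differentiableAt
    (eventually_isBitype_inChart h x (mem_chart_target E x))

theorem dbarModel_congr {k : ℕ} {α β : E → Alt E F k} {y : E} (h : α =ᶠ[𝓝 y] β) :
    dbarModel α y = dbarModel β y := by
  rw [dbarModel, dbarModel, h.fderiv_eq]

/-- The operator `∂̄` can be computed in an arbitrary chart. -/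
theorem inChart_dbar [IsManifold 𝓘(ℂ, E) ω X] {m n k : ℕ} {α : PreForm E F X k}
    (h : ∀ x, IsBitype m n (α x)) {c : X} {y : E} (hy : y ∈ (chartAt E c).target)
    (hs : SmoothAt α ((chartAt E c).symm y)) :
    inChart c (dbar α) y = dbarModel (inChart c α) y := by
  set w := (chartAt E c).symm y with hw
  have hws : w ∈ (chartAt E w).source := mem_chart_source E w
  have hsource : ∀ᶠ u in 𝓝 y, u ∈ (chartAt E c).target ∧
      (chartAt E c).symm u ∈ (chartAt E w).source :=
    Filter.Eventually.and ((chartAt E c).open_target.mem_nhds hy)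
      (((chartAt E c).continuousAt_symm hy).eventually ((chartAt E w).open_source.mem_nhds hws))
  -- The chart at `w` is now kept fixed while `u` varies, so that `dbarModel_pullback` applies to a
  -- single transition map.
  have hpull : inChart c α =ᶠ[𝓝 y] fun u =>
      (inChart w α ((chartAt E w ∘ (chartAt E c).symm) u)).compContinuousLinearMap
        (fderiv ℝ (chartAt E w ∘ (chartAt E c).symm) u) := by
    filter_upwards [hsource] with u hu
    exact inChart_eq_pullback hu.1 hu.2 α
  have hfy : (chartAt E w ∘ (chartAt E c).symm) y = chartAt E w w := rfl
  rw [inChart_apply hw.symm, dbarModel_congr hpull, dbarModel_pullback (m := m) (n := n)]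
  · rfl
  · exact hs.differentiableAt
  · exact (contDiffAt_transition_real hy hws).of_le le_top
  · filter_upwards [hsource] with u hu
    exact fderiv_transition_smul hu.1 hu.2
  · exact eventually_isBitype_inChart h w (mem_chart_target E w)

/-- `dbar` switches charts from point to point; in one fixed chart it is `dbarModel` on a whole
neighbourhood, so it can be differentiated again. -/
theorem inChart_dbar_eventuallyEq [IsManifold 𝓘(ℂ, E) ω X] {m n k : ℕ} {α : PreForm E F X k}
    (h : ∀ x, IsBitype m n (α x)) {x c : X} (hx : x ∈ (chartAt E c).source)
    (hs : ∀ᶠ z in 𝓝 x, SmoothAt α z) :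
    inChart c (dbar α) =ᶠ[𝓝 (chartAt E c x)] dbarModel (inChart c α) := by
  filter_upwards [((chartAt E c).tendsto_symm hx).eventually hs,
    (chartAt E c).open_target.mem_nhds ((chartAt E c).map_source hx)] with y hy hy'
  exact inChart_dbar h hy' hy

theorem SmoothAt.dbar [IsManifold 𝓘(ℂ, E) ω X] {m n k : ℕ} {α : PreForm E F X k}
    (h : ∀ x, IsBitype m n (α x)) {x : X} (hs : ∀ᶠ z in 𝓝 x, SmoothAt α z) :
    SmoothAt (dbar α) x := fun c hc =>
  (contDiffAt_dbarModel (hs.self_of_nhds c hc)).congr_of_eventuallyEq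
    (inChart_dbar_eventuallyEq h hc hs)

theorem dbar_dbar [IsManifold 𝓘(ℂ, E) ω X] {m n k : ℕ} {α : PreForm E F X k}
    (h : ∀ x, IsBitype m n (α x)) {x : X} (hs : ∀ᶠ z in 𝓝 x, SmoothAt α z) :
    dbar (dbar α) x = 0 := by
  rw [Dolbeault.dbar, dbarModel_congr (inChart_dbar_eventuallyEq h (mem_chart_source E x) hs)]
  exact dbarModel_dbarModel (hs.self_of_nhds x (mem_chart_source E x))

/-- The complex valued function `f` is `C^∞` at `x`. -/
def SmoothFunAt (f : X → ℂ) (x : X) : Prop :=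
  ∀ c : X, x ∈ (chartAt E c).source → ContDiffAt ℝ ∞ (f ∘ (chartAt E c).symm) (chartAt E c x)

theorem inChart_mulForm {k : ℕ} (f : X → ℂ) (α : PreForm E F X k) (c : X) :
    inChart c (mulForm f α) = fun y => (f ∘ (chartAt E c).symm) y • inChart c α y := rfl

theorem SmoothAt.mulForm {k : ℕ} {f : X → ℂ} {α : PreForm E F X k} {x : X}
    (hf : SmoothFunAt (E := E) f x) (hα : SmoothAt α x) : SmoothAt (mulForm f α) x := fun c hc =>
  (hf c hc).smul (hα c hc)

theorem dbar_ofFun_apply {f : X → ℂ} {x : X} (hf : SmoothFunAt (E := E) f x) (w : E) :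
    dbar (ofFun E f) x (fun _ => w) =
      conjPart (fderiv ℝ (f ∘ (chartAt E x).symm) (chartAt E x x)) w := by
  have h0 : inChart x (ofFun E f) = fun y =>
      ContinuousAlternatingMap.constOfIsEmptyLIE ℝ E ℂ (Fin 0) ((f ∘ (chartAt E x).symm) y) := by
    funext y
    ext v
    rfl
  have hd : DifferentiableAt ℝ (f ∘ (chartAt E x).symm) (chartAt E x x) :=
    (hf x (mem_chart_source E x)).differentiableAt (by simp)
  let C : ℂ →L[ℝ] Alt E ℂ 0 :=
    (ContinuousAlternatingMap.constOfIsEmptyLIE ℝ E ℂ (Fin 0)).toContinuousLinearEquiv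
  have h1 : HasFDerivAt (inChart x (ofFun E f))
      (C.comp (fderiv ℝ (f ∘ (chartAt E x).symm) (chartAt E x x))) (chartAt E x x) := by
    rw [h0]
    exact C.hasFDerivAt.comp _ hd.hasFDerivAt
  rw [dbar, dbarModel, h1.fderiv, ContinuousAlternatingMap.alternatizeUncurryFin_apply]
  simp [conjPart_apply, C, mul_add]

/-- The Leibniz rule `∂̄(f α) = f ∂̄α + (-1) ^ k α ∧ ∂̄f`. -/
theorem wedgeOne_dbar_ofFun {k : ℕ} {f : X → ℂ} {α : PreForm E F X k} {x : X}
    (hf : SmoothFunAt (E := E) f x) (hα : SmoothAt α x) :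
    wedgeOne (α x) (dbar (ofFun E f) x) =
      (-1 : ℂ) ^ k • (dbar (mulForm f α) x - f x • dbar α x) := by
  have hd : DifferentiableAt ℝ (f ∘ (chartAt E x).symm) (chartAt E x x) :=
    (hf x (mem_chart_source E x)).differentiableAt (by simp)
  have h1 : dbar (mulForm f α) x = f x • dbar α x +
      ContinuousAlternatingMap.alternatizeUncurryFin
        ((conjPart (fderiv ℝ (f ∘ (chartAt E x).symm) (chartAt E x x))).smulRight (α x)) := by
    rw [dbar, inChart_mulForm, dbarModel_smul_fun hd hα.differentiableAt, inChart_self,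
      Function.comp_apply, (chartAt E x).left_inv (mem_chart_source E x)]
    rfl
  rw [h1, add_sub_cancel_left, wedgeOne]
  congr 3
  ext1 w
  exact dbar_ofFun_apply hf w

end Charts

theorem exists_opens_isCompact_closure {X : Type*} [TopologicalSpace X] [T2Space X]
    [LocallyCompactSpace X] (K : Compacts X) {V : Opens X} (hV : (K : Set X) ⊆ V) :
    ∃ V' : Opens X, (K : Set X) ⊆ V' ∧ V' ≤ V ∧ IsCompact (closure (V' : Set X)) := by
  obtain ⟨V', hV', hK, hcl, hc⟩ := exists_open_between_and_isCompact_closure K.isCompact V.isOpen hV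
  exact ⟨⟨V', hV'⟩, hK, subset_closure.trans hcl, hc⟩

/-! ### Cutoff functions and forms vanishing near `K`. -/

section Cutoff

variable {E F : Type*} [NormedAddCommGroup E] [NormedSpace ℂ E]
  [NormedAddCommGroup F] [NormedSpace ℂ F] {X : Type*} [TopologicalSpace X] [ChartedSpace E X]

variable (E) in
/-- A `C^∞` function with compact support in `V` that equals `1` in a neighbourhood of `K`. -/
structure IsCutoff (K : Set X) (V : Opens X) (χ : X → ℂ) : Prop where
  smooth : ∀ x, SmoothFunAt (E := E) χ x
  eq_one : ∃ W : Opens X, K ⊆ W ∧ ∀ x ∈ W, χ x = 1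
  support : ∃ C : Set X, IsCompact C ∧ C ⊆ V ∧ ∀ x ∉ C, χ x = 0

/-- The support of `ρ 0` misses `K`, so `ρ 1 = 1` off that support, which is a neighbourhood of `K`.
Relative compactness of `V` makes the support of `ρ 1` compact. -/
theorem isCutoff_of_isSubordinate [IsManifold 𝓘(ℂ, E) ω X] {K : Set X} {V : Opens X}
    (hV : IsCompact (closure (V : Set X))) {ρ : SmoothPartitionOfUnity (Fin 2) 𝓘(ℝ, E) X univ}
    (hρ : ρ.IsSubordinate ![Kᶜ, (V : Set X)]) : IsCutoff E K V fun x => (ρ 1 x : ℂ) where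
  smooth x c hc := by
    have := isManifold_real E X
    have h := ((contMDiffAt_iff_of_mem_source (y := ρ 1 x) hc (mem_chart_source ℝ _)).1
      ((ρ 1).contMDiff x)).2
    have h' : ContDiffAt ℝ ∞ (ρ 1 ∘ (chartAt E c).symm) (chartAt E c x) := by
      simpa [contDiffWithinAt_univ, chartAt_self_eq] using h
    exact Complex.ofRealCLM.contDiff.contDiffAt.comp _ h'
  eq_one := by
    refine ⟨⟨(tsupport (ρ 0))ᶜ, (isClosed_tsupport _).isOpen_compl⟩,
      fun x hx hx' => (hρ 0 hx' : x ∈ Kᶜ) hx, fun x hx => ?_⟩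
    have h0 : ρ 0 x = 0 := image_eq_zero_of_notMem_tsupport hx
    have h1 := ρ.sum_eq_one (mem_univ x)
    rw [finsum_eq_sum_of_fintype, Fin.sum_univ_two, h0, zero_add] at h1
    simp [h1]
  support := by
    have h1 : tsupport (ρ 1) ⊆ V := hρ 1
    refine ⟨tsupport (ρ 1), hV.of_isClosed_subset (isClosed_tsupport _)
      (h1.trans subset_closure), h1, fun x hx => ?_⟩
    have h0 : ρ 1 x = 0 := image_eq_zero_of_notMem_tsupport hx
    simp [h0]

theorem IsCutoff.mono {K : Set X} {V V' : Opens X} {χ : X → ℂ} (hχ : IsCutoff E K V χ)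
    (h : V ≤ V') : IsCutoff E K V' χ :=
  ⟨hχ.smooth, hχ.eq_one, hχ.support.imp fun _ hC => ⟨hC.1, hC.2.1.trans h, hC.2.2⟩⟩

section Existence

variable [FiniteDimensional ℂ E] [IsManifold 𝓘(ℂ, E) ω X] [T2Space X]

theorem exists_isSubordinate [SecondCountableTopology X] (K : Compacts X) {V : Opens X}
    (hV : (K : Set X) ⊆ V) : ∃ ρ : SmoothPartitionOfUnity (Fin 2) 𝓘(ℝ, E) X univ,
      ρ.IsSubordinate ![(K : Set X)ᶜ, (V : Set X)] := by
  have := isManifold_real E X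
  have : FiniteDimensional ℝ E := FiniteDimensional.complexToReal E
  have : LocallyCompactSpace X := ChartedSpace.locallyCompactSpace E X
  refine SmoothPartitionOfUnity.exists_isSubordinate _ isClosed_univ _ (fun i => ?_) fun x _ => ?_
  · fin_cases i
    · exact K.isCompact.isClosed.isOpen_compl
    · exact V.isOpen
  · rw [mem_iUnion]
    by_cases hx : x ∈ (K : Set X)
    · exact ⟨1, hV hx⟩
    · exact ⟨0, hx⟩

variable (E) in
theorem exists_isCutoff [SecondCountableTopology X] (K : Compacts X) {V : Opens X}
    (hV : (K : Set X) ⊆ V) : ∃ χ : X → ℂ, IsCutoff E (K : Set X) V χ := by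
  have : LocallyCompactSpace E := by
    have := FiniteDimensional.proper ℂ E
    infer_instance
  have : LocallyCompactSpace X := ChartedSpace.locallyCompactSpace E X
  obtain ⟨V', hK, hV', hc⟩ := exists_opens_isCompact_closure K hV
  obtain ⟨ρ, hρ⟩ := exists_isSubordinate (E := E) K hK
  exact ⟨_, (isCutoff_of_isSubordinate hc hρ).mono hV'⟩

end Existence

theorem dbar_sub {k : ℕ} {α β : PreForm E F X k} {x : X} (hα : SmoothAt α x) (hβ : SmoothAt β x) :
    dbar (α - β) x = dbar α x - dbar β x := by
  have h : α - β = α + (-1 : ℂ) • β := by rw [neg_one_smul, sub_eq_add_neg]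
  rw [h, dbar_add hα (hβ.smul _), dbar_smul _ hβ, neg_one_smul, sub_eq_add_neg]

theorem dbar_congr_of_eqOn {k : ℕ} {α β : PreForm E F X k} {W : Opens X}
    (h : ∀ x ∈ W, α x = β x) {x : X} (hx : x ∈ W) : dbar α x = dbar β x := by
  refine dbar_congr ?_
  filter_upwards [W.isOpen.mem_nhds hx] with y hy
  exact h y hy

variable [T2Space X]

theorem IsCutoff.mulForm_mem_forms {K : Set X} {V : Opens X} {χ : X → ℂ} (hχ : IsCutoff E K V χ)
    {p q : ℕ} {α : PreForm E F X (p + q)} (hα : α ∈ forms E F .all p q V) :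
    mulForm χ α ∈ forms E F .compact p q (⊤ : Opens X) := by
  obtain ⟨C, hC, hCV, hCχ⟩ := hχ.support
  refine extend_mem_forms (U := V) le_top ⟨fun x hx => ?_, fun x hx => (hα.2.1 x hx).mulForm
    (hχ.smooth x), fun x => IsBitype.smul (hα.2.2.1 x) _,
    fun _ => ⟨C, hC, hCV, fun x hx => ?_⟩⟩
  · rw [mulForm_apply, hα.1 x hx, smul_zero]
  · rw [mulForm_apply, hCχ x hx, zero_smul]

theorem mem_forms_complement {K : Compacts X} {p q : ℕ} {θ : PreForm E F X (p + q)}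
    (hθ : θ ∈ forms E F .compact p q (⊤ : Opens X)) {W : Opens X} (hKW : (K : Set X) ⊆ W)
    (hW : ∀ x ∈ W, θ x = 0) : θ ∈ forms E F .compact p q (complement K) := by
  obtain ⟨C, hC, -, hCθ⟩ := hθ.2.2.2 rfl
  refine ⟨fun x hx => hW x (hKW (not_not.1 hx)), fun x _ => hθ.2.1 x trivial, hθ.2.2.1,
    fun _ => ⟨C \ W, hC.diff W.isOpen, fun x hx hxK => hx.2 (hKW hxK), fun x hx => ?_⟩⟩
  by_cases hxW : x ∈ W
  · exact hW x hxW
  · exact hCθ x fun hxC => hx ⟨hxC, hxW⟩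

theorem mem_cocycles_complement {K : Compacts X} {p q : ℕ} {θ : PreForm E F X (p + q)}
    (hθ : θ ∈ cocycles E F .compact p q (⊤ : Opens X)) {W : Opens X} (hKW : (K : Set X) ⊆ W)
    (hW : ∀ x ∈ W, θ x = 0) : θ ∈ cocycles E F .compact p q (complement K) :=
  ⟨mem_forms_complement hθ.1 hKW hW, fun x _ => hθ.2 x trivial⟩

theorem dbar_mem_cocycles [IsManifold 𝓘(ℂ, E) ω X] {p q : ℕ} {θ : PreForm E F X (p + q)}
    (hθ : θ ∈ forms E F .compact p q (⊤ : Opens X)) :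
    (dbar θ : PreForm E F X (p + (q + 1))) ∈
      cocycles E F .compact p (q + 1) (⊤ : Opens X) := by
  have hs : ∀ x, ∀ᶠ z in 𝓝 x, SmoothAt θ z := fun x =>
    Filter.Eventually.of_forall fun z => hθ.2.1 z trivial
  obtain ⟨C, hC, hCU, hCθ⟩ := hθ.2.2.2 rfl
  refine ⟨⟨fun x hx => (hx trivial).elim, fun x _ => SmoothAt.dbar (m := p) (n := q) hθ.2.2.1 (hs x),
    fun x => isBitype_dbar hθ.2.2.1 (hθ.2.1 x trivial), fun _ => ⟨C, hC, hCU, fun x hx => ?_⟩⟩,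
    fun x _ => dbar_dbar (m := p) (n := q) hθ.2.2.1 (hs x)⟩
  rw [dbar_congr_of_eqOn (β := 0) (W := ⟨Cᶜ, hC.isClosed.isOpen_compl⟩) hCθ hx, dbar_zero]

variable [FiniteDimensional ℂ E] [IsManifold 𝓘(ℂ, E) ω X] [SecondCountableTopology X]

/-- A compactly supported form that is exact near `K` differs by an exact compactly supported form
from a form with compact support in the complement of `K`. -/
theorem exists_forms_complement {K : Compacts X} {p q : ℕ} {θ : PreForm E F X (p + q)}
    (hθ : θ ∈ forms E F .compact p q (⊤ : Opens X)) {W : Opens X} (hKW : (K : Set X) ⊆ W)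
    (hW : restrict E F W θ ∈ coboundaries E F .all p q W) :
    ∃ θ' ∈ forms E F .compact p q (complement K), (∀ x, dbar θ' x = dbar θ x) ∧
      θ - θ' ∈ coboundaries E F .compact p q (⊤ : Opens X) := by
  cases q with
  | zero =>
    -- Exact forms with `q = 0` are zero, so `θ` itself already vanishes near `K`.
    have h0 : restrict E F W θ = 0 := hW
    refine ⟨θ, mem_forms_complement hθ hKW fun x hx => ?_, fun x => rfl, ?_⟩
    · rw [← restrict_of_mem θ hx, h0]
      rfl
    · rw [sub_self]
      exact zero_mem _
  | succ q =>
    obtain ⟨ζ, hζ, h⟩ := hW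
    obtain ⟨χ, hχ⟩ := exists_isCutoff E K hKW
    obtain ⟨W', hKW', h1⟩ := hχ.eq_one
    have hχζ := hχ.mulForm_mem_forms hζ
    have hd := dbar_mem_cocycles hχζ
    -- Where `χ = 1` this is `θ - ∂̄ζ = 0`, and `χζ` is the compactly supported primitive of the
    -- correction.
    refine ⟨θ - dbar (mulForm χ ζ), mem_forms_complement (W := W ⊓ W') (sub_mem hθ hd.1)
      (subset_inter hKW hKW') fun x hx => ?_, fun x => ?_, mulForm χ ζ, hχζ, fun x _ => ?_⟩
    · have h2 : dbar (mulForm χ ζ) x = dbar ζ x :=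
        dbar_congr_of_eqOn (W := W') (fun y hy => by rw [mulForm_apply, h1 y hy, one_smul]) hx.2
      rw [Pi.sub_apply, h2, ← h x hx.1, restrict_of_mem θ hx.1, sub_self]
    · rw [dbar_sub (hθ.2.1 x trivial) (hd.1.2.1 x trivial), hd.2 x trivial, sub_zero]
    · rw [sub_sub_cancel]

/-- `θ` may be nonzero near `K`, hence no primitive on `X ∖ K` with compact support; the modified
form `θ'` is one and has the same `∂̄`. -/
theorem dbar_mem_coboundaries_complement {K : Compacts X} {p q : ℕ} {θ : PreForm E F X (p + q)}
    (hθ : θ ∈ forms E F .compact p q (⊤ : Opens X)) {W : Opens X} (hKW : (K : Set X) ⊆ W)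
    (hW : restrict E F W θ ∈ coboundaries E F .all p q W) :
    (dbar θ : PreForm E F X (p + (q + 1))) ∈
      coboundaries E F .compact p (q + 1) (complement K) := by
  obtain ⟨θ', hθ', h, -⟩ := exists_forms_complement hθ hKW hW
  exact ⟨θ', hθ', fun x _ => (h x).symm⟩

end Cutoff

/-! ### Representatives of classes in the direct limit. -/

section Germs

variable {E F : Type*} [NormedAddCommGroup E] [NormedSpace ℂ E]
  [NormedAddCommGroup F] [NormedSpace ℂ F] {X : Type*} [TopologicalSpace X] [ChartedSpace E X]

theorem cls_eq_cls {Φ : Supports} {p q : ℕ} {U : Opens X} {α β : cocycles E F Φ p q U} :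
    cls E F Φ p q U α = cls E F Φ p q U β ↔ α.1 - β.1 ∈ coboundaries E F Φ p q U :=
  Submodule.Quotient.eq _

theorem cls_eq_zero {Φ : Supports} {p q : ℕ} {U : Opens X} {α : cocycles E F Φ p q U} :
    cls E F Φ p q U α = 0 ↔ α.1 ∈ coboundaries E F Φ p q U :=
  Submodule.Quotient.mk_eq_zero _

theorem restrict_restrict {k : ℕ} {V W : Opens X} (h : W ≤ V) (α : PreForm E F X k) :
    restrict E F W (restrict E F V α) = restrict E F W α := by
  funext x
  by_cases hx : x ∈ W
  · rw [restrict_of_mem _ hx, restrict_of_mem _ hx, restrict_of_mem _ (h hx)]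
  · rw [restrict_of_notMem _ hx, restrict_of_notMem _ hx]

theorem restrict_congr {k : ℕ} {W : Opens X} {α β : PreForm E F X k} (h : ∀ x ∈ W, α x = β x) :
    restrict E F W α = restrict E F W β := by
  funext x
  by_cases hx : x ∈ W
  · rw [restrict_of_mem _ hx, restrict_of_mem _ hx, h x hx]
  · rw [restrict_of_notMem _ hx, restrict_of_notMem _ hx]

/-- The restriction of a closed form to a smaller open set. -/
abbrev resCocycle {p q : ℕ} {U V : Opens X} (h : V ≤ U) (α : cocycles E F .all p q U) :
    cocycles E F .all p q V :=
  ⟨restrict E F V α.1, restrict_mem_cocycles h α.2⟩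

theorem resMap_cls {p q : ℕ} {U V : Opens X} (h : V ≤ U) (α : cocycles E F .all p q U) :
    resMap E F p q h (cls E F .all p q U α) = cls E F .all p q V (resCocycle h α) := rfl

theorem toGerm_resMap {p q : ℕ} {K : Compacts X} {V W : OpenNhd K} (h : W.1 ≤ V.1)
    (c : Cohomology E F .all p q V.1) :
    toGerm E F p q W (resMap E F p q h c) = toGerm E F p q V c := by
  classical
  exact Module.DirectLimit.of_f (R := ℂ) (ι := (OpenNhd K)ᵒᵈ) (i := OrderDual.toDual V)
    (j := OrderDual.toDual W) (hij := h)

instance isDirectedOrder_openNhd (K : Compacts X) : IsDirectedOrder (OpenNhd K)ᵒᵈ where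
  directed V W := ⟨OrderDual.toDual ⟨(OrderDual.ofDual V).1 ⊓ (OrderDual.ofDual W).1,
    subset_inter (OrderDual.ofDual V).2 (OrderDual.ofDual W).2⟩,
    (inf_le_left : _ ⊓ _ ≤ (OrderDual.ofDual V).1), (inf_le_right : _ ⊓ _ ≤ (OrderDual.ofDual W).1)⟩

instance nonempty_openNhd (K : Compacts X) : Nonempty (OpenNhd K)ᵒᵈ :=
  ⟨OrderDual.toDual (OpenNhd.top K)⟩

theorem directedSystem_cohomology (p q : ℕ) (K : Compacts X) :
    DirectedSystem (fun V : (OpenNhd K)ᵒᵈ => Cohomology E F .all p q (OrderDual.ofDual V).1)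
      (fun _ _ h => resMap E F p q (OrderDual.ofDual_le_ofDual.2 h)) where
  map_self V c := by
    obtain ⟨α, rfl⟩ := Submodule.mkQ_surjective _ c
    refine congrArg _ (Subtype.ext (funext fun x => ?_))
    by_cases hx : x ∈ (OrderDual.ofDual V).1
    · exact restrict_of_mem _ hx
    -- Forms on `V` are stored with value zero outside `V`.
    · exact (restrict_of_notMem _ hx).trans (α.2.1.1 x hx).symm
  map_map U V W h h' c := by
    obtain ⟨α, rfl⟩ := Submodule.mkQ_surjective _ c
    exact congrArg _ (Subtype.ext (restrict_restrict (OrderDual.ofDual_le_ofDual.2 h') _))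

theorem exists_toGerm_cls {p q : ℕ} {K : Compacts X} (z : GermCohomology E F p q K) :
    ∃ (V : OpenNhd K) (η : cocycles E F .all p q V.1),
      toGerm E F p q V (cls E F .all p q V.1 η) = z := by
  classical
  obtain ⟨V, c, hc⟩ := Module.DirectLimit.exists_of z
  obtain ⟨η, rfl⟩ := Submodule.mkQ_surjective _ c
  exact ⟨OrderDual.ofDual V, η, hc⟩

theorem exists_restrict_mem_coboundaries {p q : ℕ} {K : Compacts X} {V : OpenNhd K}
    {η : cocycles E F .all p q V.1} (h : toGerm E F p q V (cls E F .all p q V.1 η) = 0) :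
    ∃ W : OpenNhd K, W.1 ≤ V.1 ∧ restrict E F W.1 η.1 ∈ coboundaries E F .all p q W.1 := by
  classical
  obtain ⟨W, hW, h0⟩ := @Module.DirectLimit.of.zero_exact ℂ _ (OpenNhd K)ᵒᵈ _
    (fun V => Cohomology E F .all p q (OrderDual.ofDual V).1) _ _
    (fun _ _ h => resMap E F p q (OrderDual.ofDual_le_ofDual.2 h)) _
    (directedSystem_cohomology p q K) _ _ _ h
  exact ⟨OrderDual.ofDual W, hW, cls_eq_zero.1 h0⟩

/-- Closed forms that agree near `K` have the same class in the cohomology of `K`. -/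
theorem toGerm_cls_eq {p q : ℕ} {K : Compacts X} {V V' W : OpenNhd K} (h : W.1 ≤ V.1)
    (h' : W.1 ≤ V'.1) {η : cocycles E F .all p q V.1} {η' : cocycles E F .all p q V'.1}
    (heq : ∀ x ∈ W.1, η.1 x = η'.1 x) :
    toGerm E F p q V (cls E F .all p q V.1 η) = toGerm E F p q V' (cls E F .all p q V'.1 η') := by
  rw [← toGerm_resMap h, ← toGerm_resMap h', resMap_cls, resMap_cls]
  congr 2
  exact Subtype.ext (restrict_congr heq)

theorem jStar_cls {p q : ℕ} {K : Compacts X} (α : cocycles E F .compact p q (⊤ : Opens X)) :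
    jStar E F p q K (cls E F .compact p q ⊤ α) = toGerm E F p q (OpenNhd.top K)
      (cls E F .all p q (OpenNhd.top K).1 ⟨α.1, forget_mem_cocycles α.2⟩) := rfl

theorem iStar_cls [T2Space X] {p q : ℕ} {K : Compacts X}
    (α : cocycles E F .compact p q (complement K)) :
    iStar E F p q K (cls E F .compact p q (complement K) α) =
      cls E F .compact p q ⊤ ⟨α.1, extend_mem_cocycles le_top α.2⟩ := rfl

end Germs

/-! ### Construction and uniqueness of the connecting map. -/

section Connecting

variable {E F : Type*} [NormedAddCommGroup E] [NormedSpace ℂ E]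
  [NormedAddCommGroup F] [NormedSpace ℂ F]

theorem wedgeOne_add {k : ℕ} (η η' : Alt E F k) (β : Alt E ℂ 1) :
    wedgeOne (η + η') β = wedgeOne η β + wedgeOne η' β := by
  ext v
  simp only [wedgeOne_apply, ContinuousAlternatingMap.add_apply, smul_add, Finset.sum_add_distrib]

theorem wedgeOne_smul {k : ℕ} (a : ℂ) (η : Alt E F k) (β : Alt E ℂ 1) :
    wedgeOne (a • η) β = a • wedgeOne η β := by
  ext v
  simp only [wedgeOne_apply, ContinuousAlternatingMap.smul_apply, Finset.smul_sum]
  exact Finset.sum_congr rfl fun i _ => smul_comm _ _ _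

variable {X : Type*} [TopologicalSpace X] [ChartedSpace E X] [T2Space X]

/-- On `V` this is the Leibniz rule with `∂̄η = 0`; at other points `χη` vanishes in a
neighbourhood. -/
theorem IsCutoff.wedgeOne_eq {K : Set X} {V : Opens X} {χ : X → ℂ} (hχ : IsCutoff E K V χ)
    {p q : ℕ} {η : PreForm E F X (p + q)} (hη : η ∈ cocycles E F .all p q V) (x : X) :
    wedgeOne (η x) (dbar (ofFun E χ) x) = (-1 : ℂ) ^ (p + q) • dbar (mulForm χ η) x := by
  by_cases hx : x ∈ V
  · rw [wedgeOne_dbar_ofFun (hχ.smooth x) (hη.1.2.1 x hx), hη.2 x hx, smul_zero, sub_zero]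
  · obtain ⟨C, hC, hCV, hCχ⟩ := hχ.support
    have h0 : dbar (mulForm χ η) x = 0 := by
      rw [dbar_congr_of_eqOn (β := 0) (W := ⟨Cᶜ, hC.isClosed.isOpen_compl⟩)
        (fun y hy => by rw [mulForm_apply, hCχ y hy, zero_smul]; rfl) fun hxC => hx (hCV hxC),
        dbar_zero]
    have h1 := wedgeOne_smul 0 (0 : Alt E F (p + q)) (dbar (ofFun E χ) x)
    rw [zero_smul, zero_smul] at h1
    rw [hη.1.1 x hx, h0, smul_zero, h1]

variable [IsManifold 𝓘(ℂ, E) ω X]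

/-- Near `K` the form `χη` equals the closed form `η`, so its `∂̄` vanishes there. -/
theorem IsCutoff.dbar_mulForm_mem_cocycles {K : Compacts X} {V : Opens X} {χ : X → ℂ}
    (hχ : IsCutoff E (K : Set X) V χ) {p q : ℕ} {η : PreForm E F X (p + q)}
    (hη : η ∈ cocycles E F .all p q V) (hKV : (K : Set X) ⊆ V) :
    (dbar (mulForm χ η) : PreForm E F X (p + (q + 1))) ∈
      cocycles E F .compact p (q + 1) (complement K) := by
  obtain ⟨W, hKW, hW⟩ := hχ.eq_one
  refine mem_cocycles_complement (W := V ⊓ W) (dbar_mem_cocycles (hχ.mulForm_mem_forms hη.1))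
    (subset_inter hKV hKW) fun x hx => ?_
  rw [← hη.2 x hx.1]
  exact dbar_congr_of_eqOn (W := W) (fun y hy => by rw [mulForm_apply, hW y hy, one_smul]) hx.2

/-- The map `η ↦ η ∧ ∂̄χ` on closed forms. -/
def wedgeCutoff (p q : ℕ) {K : Compacts X} (V : OpenNhd K) {χ : X → ℂ}
    (hχ : IsCutoff E (K : Set X) V.1 χ) :
    cocycles E F .all p q V.1 →ₗ[ℂ] cocycles E F .compact p (q + 1) (complement K) where
  toFun η := ⟨fun x => wedgeOne (η.1 x) (dbar (ofFun E χ) x), by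
    have h : (fun x => wedgeOne (η.1 x) (dbar (ofFun E χ) x)) =
        (-1 : ℂ) ^ (p + q) • dbar (mulForm χ η.1) := funext (hχ.wedgeOne_eq η.2)
    rw [h]
    exact Submodule.smul_mem _ _ (hχ.dbar_mulForm_mem_cocycles η.2 V.2)⟩
  map_add' _ _ := Subtype.ext (funext fun _ => wedgeOne_add _ _ _)
  map_smul' _ _ := Subtype.ext (funext fun _ => wedgeOne_smul _ _ _)

theorem wedgeCutoff_apply {p q : ℕ} {K : Compacts X} {V : OpenNhd K} {χ : X → ℂ}
    (hχ : IsCutoff E (K : Set X) V.1 χ) (η : cocycles E F .all p q V.1) (x : X) :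
    (wedgeCutoff p q V hχ η).1 x = (-1 : ℂ) ^ (p + q) • dbar (mulForm χ η.1) x :=
  hχ.wedgeOne_eq η.2 x

variable [FiniteDimensional ℂ E] [SecondCountableTopology X]

/-- If `θ` is a compactly supported form that is cohomologous to `η` near `K`, then
`η ∧ ∂̄χ` is cohomologous to `± ∂̄θ`. -/
theorem cls_wedgeCutoff_eq {p q : ℕ} {K : Compacts X} {V : OpenNhd K} {χ : X → ℂ}
    (hχ : IsCutoff E (K : Set X) V.1 χ) (η : cocycles E F .all p q V.1)
    {θ : PreForm E F X (p + q)} (hθ : θ ∈ forms E F .compact p q (⊤ : Opens X)) {W : Opens X}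
    (hKW : (K : Set X) ⊆ W)
    (hW : restrict E F W (η.1 - θ) ∈ coboundaries E F .all p q W)
    {α : cocycles E F .compact p (q + 1) (complement K)}
    (hα : ∀ x, α.1 x = (-1 : ℂ) ^ (p + q) • dbar θ x) :
    cls E F .compact p (q + 1) (complement K) (wedgeCutoff p q V hχ η) =
      cls E F .compact p (q + 1) (complement K) α := by
  obtain ⟨W', hKW', h1⟩ := hχ.eq_one
  have hχη := hχ.mulForm_mem_forms η.2.1
  have heq : (wedgeCutoff p q V hχ η).1 - α.1 =
      (-1 : ℂ) ^ (p + q) • dbar (mulForm χ η.1 - θ) := by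
    funext x
    rw [Pi.sub_apply, wedgeCutoff_apply, hα, Pi.smul_apply,
      dbar_sub (hχη.2.1 x trivial) (hθ.2.1 x trivial), smul_sub]
  rw [cls_eq_cls, heq]
  -- Near `K`, `χη - θ` equals `η - θ`, which is exact there.
  refine Submodule.smul_mem _ _ (dbar_mem_coboundaries_complement (W := W ⊓ W')
    (sub_mem hχη hθ) (subset_inter hKW hKW') ?_)
  have h2 : restrict E F (W ⊓ W') (mulForm χ η.1 - θ) =
      restrict E F (W ⊓ W') (restrict E F W (η.1 - θ)) := by
    rw [restrict_restrict inf_le_left]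
    refine restrict_congr fun x hx => ?_
    rw [Pi.sub_apply, Pi.sub_apply, mulForm_apply, h1 x hx.2, one_smul]
  rw [h2]
  exact restrict_mem_coboundaries inf_le_left hW

/-- Independence of neighbourhood, cutoff and representative at once: take `θ = χ'η'`, which is `η'`
near `K`. -/
theorem cls_wedgeCutoff_congr {p q : ℕ} {K : Compacts X} {V V' : OpenNhd K} {χ χ' : X → ℂ}
    (hχ : IsCutoff E (K : Set X) V.1 χ) (hχ' : IsCutoff E (K : Set X) V'.1 χ')
    (η : cocycles E F .all p q V.1) (η' : cocycles E F .all p q V'.1) {W : Opens X}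
    (hKW : (K : Set X) ⊆ W)
    (hW : restrict E F W (η.1 - η'.1) ∈ coboundaries E F .all p q W) :
    cls E F .compact p (q + 1) (complement K) (wedgeCutoff p q V hχ η) =
      cls E F .compact p (q + 1) (complement K) (wedgeCutoff p q V' hχ' η') := by
  obtain ⟨W', hKW', h1⟩ := hχ'.eq_one
  refine cls_wedgeCutoff_eq hχ η (hχ'.mulForm_mem_forms η'.2.1) (W := W ⊓ W')
    (subset_inter hKW hKW') ?_ (wedgeCutoff_apply hχ' η')
  have h2 : restrict E F (W ⊓ W') (η.1 - mulForm χ' η'.1) =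
      restrict E F (W ⊓ W') (restrict E F W (η.1 - η'.1)) := by
    rw [restrict_restrict inf_le_left]
    refine restrict_congr fun x hx => ?_
    rw [Pi.sub_apply, Pi.sub_apply, mulForm_apply, h1 x hx.2, one_smul]
  rw [h2]
  exact restrict_mem_coboundaries inf_le_left hW

/-- A cutoff function for each neighbourhood of `K`. -/
def cutoff (E : Type*) [NormedAddCommGroup E] [NormedSpace ℂ E] [FiniteDimensional ℂ E]
    [ChartedSpace E X] [IsManifold 𝓘(ℂ, E) ω X] {K : Compacts X} (V : OpenNhd K) : X → ℂ :=
  (exists_isCutoff E K V.2).choose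

theorem isCutoff_cutoff {K : Compacts X} (V : OpenNhd K) :
    IsCutoff E (K : Set X) V.1 (cutoff E V) :=
  (exists_isCutoff E K V.2).choose_spec

variable (E F) in
/-- The connecting map on the cohomology of a neighbourhood of `K`. -/
def connectingNhd (p q : ℕ) {K : Compacts X} (V : OpenNhd K) :
    Cohomology E F .all p q V.1 →ₗ[ℂ] Cohomology E F .compact p (q + 1) (complement K) :=
  Submodule.liftQ _ ((cls E F .compact p (q + 1) (complement K)).comp
    (wedgeCutoff p q V (isCutoff_cutoff V))) fun η hη => by
      rw [LinearMap.mem_ker, LinearMap.comp_apply,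
        cls_wedgeCutoff_congr _ (isCutoff_cutoff V) η 0 V.2, map_zero, map_zero]
      rw [ZeroMemClass.coe_zero, sub_zero]
      exact restrict_mem_coboundaries le_rfl hη

open Classical in
variable (E F) in
/-- The connecting map `γ^*`. -/
def connecting (p q : ℕ) (K : Compacts X) :
    GermCohomology E F p q K →ₗ[ℂ] Cohomology E F .compact p (q + 1) (complement K) :=
  Module.DirectLimit.lift _ _ _ _ (fun V => connectingNhd E F p q (OrderDual.ofDual V))
    fun V W h c => by
      obtain ⟨η, rfl⟩ := Submodule.mkQ_surjective _ c
      change connectingNhd E F p q (OrderDual.ofDual W) (cls E F .all p q _ (resCocycle h η)) =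
        connectingNhd E F p q (OrderDual.ofDual V) (cls E F .all p q _ η)
      refine cls_wedgeCutoff_congr _ _ (resCocycle _ η) η (OrderDual.ofDual W).2 ?_
      rw [map_sub, restrict_restrict le_rfl, sub_self]
      exact zero_mem _

open Classical in
theorem connecting_toGerm {p q : ℕ} {K : Compacts X} {V : OpenNhd K} {χ : X → ℂ}
    (hχ : IsCutoff E (K : Set X) V.1 χ) (η : cocycles E F .all p q V.1) :
    connecting E F p q K (toGerm E F p q V (cls E F .all p q V.1 η)) =
      cls E F .compact p (q + 1) (complement K) (wedgeCutoff p q V hχ η) := by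
  have h : connecting E F p q K (toGerm E F p q V (cls E F .all p q V.1 η)) =
      connectingNhd E F p q V (cls E F .all p q V.1 η) :=
    Module.DirectLimit.lift_of _ _ _
  rw [h]
  refine cls_wedgeCutoff_congr (isCutoff_cutoff V) hχ η η V.2 ?_
  rw [sub_self, map_zero]
  exact zero_mem _

theorem isConnectingMap_connecting (p q : ℕ) (K : Compacts X) :
    IsConnectingMap E F p q K (connecting E F p q K) := fun V hV η _ hρ =>
  ⟨wedgeCutoff p q V (isCutoff_of_isSubordinate hV hρ) η, fun _ => rfl, connecting_toGerm _ η⟩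

/-- Every germ class has a representative on a relatively compact neighbourhood, where some
partition of unity prescribes the value. -/
theorem IsConnectingMap.eq {p q : ℕ} {K : Compacts X}
    {γ γ' : GermCohomology E F p q K →ₗ[ℂ] Cohomology E F .compact p (q + 1) (complement K)}
    (h : IsConnectingMap E F p q K γ) (h' : IsConnectingMap E F p q K γ') : γ = γ' := by
  have : LocallyCompactSpace E := by
    have := FiniteDimensional.proper ℂ E
    infer_instance
  have : LocallyCompactSpace X := ChartedSpace.locallyCompactSpace E X
  ext1 z
  obtain ⟨V, η, rfl⟩ := exists_toGerm_cls z
  obtain ⟨V', hK, hV', hc⟩ := exists_opens_isCompact_closure K V.2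
  obtain ⟨ρ, hρ⟩ := exists_isSubordinate (E := E) K hK
  rw [← toGerm_resMap (W := ⟨V', hK⟩) hV', resMap_cls]
  obtain ⟨α, hα, hγ⟩ := h ⟨V', hK⟩ hc (resCocycle hV' η) ρ hρ
  obtain ⟨α', hα', hγ'⟩ := h' ⟨V', hK⟩ hc (resCocycle hV' η) ρ hρ
  rw [hγ, hγ']
  congr 1
  exact Subtype.ext (funext fun x => (hα x).trans (hα' x).symm)

end Connecting

/-! ### Exactness of the sequence. -/

section Exactness

variable {E F : Type*} [NormedAddCommGroup E] [NormedSpace ℂ E] [FiniteDimensional ℂ E]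
  [NormedAddCommGroup F] [NormedSpace ℂ F] {X : Type*} [TopologicalSpace X] [ChartedSpace E X]
  [IsManifold 𝓘(ℂ, E) ω X] [T2Space X] [SecondCountableTopology X]

-- For `q = 0` nothing nonzero is exact, so the map is the inclusion of forms.
omit [FiniteDimensional ℂ E] [IsManifold 𝓘(ℂ, E) ω X] [SecondCountableTopology X] in
theorem injective_iStar_zero (p : ℕ) (K : Compacts X) :
    Function.Injective (iStar E F p 0 K) := by
  rw [injective_iff_map_eq_zero]
  intro a ha
  obtain ⟨α, rfl⟩ := Submodule.mkQ_surjective _ a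
  exact cls_eq_zero.2 (cls_eq_zero.1 ha : α.1 ∈ coboundaries E F .compact p 0 ⊤)

theorem exact_iStar_jStar (p q : ℕ) (K : Compacts X) :
    Function.Exact (iStar E F p q K) (jStar E F p q K) := by
  intro a
  constructor
  · intro ha
    obtain ⟨α, rfl⟩ := Submodule.mkQ_surjective _ a
    obtain ⟨W, -, hW⟩ := exists_restrict_mem_coboundaries ((jStar_cls α).symm.trans ha)
    obtain ⟨θ, hθ, hd, hα⟩ := exists_forms_complement α.2.1 W.2 hW
    have hθ' : θ ∈ cocycles E F .compact p q (complement K) :=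
      ⟨hθ, fun x _ => (hd x).trans (α.2.2 x trivial)⟩
    refine ⟨cls E F .compact p q (complement K) ⟨θ, hθ'⟩, ?_⟩
    rw [iStar_cls]
    exact (cls_eq_cls.2 hα).symm
  · rintro ⟨b, rfl⟩
    obtain ⟨β, rfl⟩ := Submodule.mkQ_surjective _ b
    obtain ⟨C, hC, hCK, hCβ⟩ := β.2.1.2.2.2 rfl
    let W : OpenNhd K := ⟨⟨Cᶜ, hC.isClosed.isOpen_compl⟩, fun x hx hxC => hCK hxC hx⟩
    have h := toGerm_cls_eq (V := OpenNhd.top K) (V' := OpenNhd.top K) (W := W) le_top le_top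
      (η := ⟨β.1, forget_mem_cocycles (extend_mem_cocycles le_top β.2)⟩) (η' := 0) hCβ
    rw [map_zero, map_zero] at h
    exact h

theorem exact_jStar_connecting (p q : ℕ) (K : Compacts X) :
    Function.Exact (jStar E F p q K) (connecting E F p q K) := by
  intro z
  have hs : (-1 : ℂ) ^ (p + q) * (-1 : ℂ) ^ (p + q) = 1 := by
    rw [← mul_pow, neg_one_mul, neg_neg, one_pow]
  constructor
  · intro hz
    obtain ⟨V, η, rfl⟩ := exists_toGerm_cls z
    have hχ := isCutoff_cutoff (E := E) V
    rw [connecting_toGerm hχ, cls_eq_zero] at hz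
    obtain ⟨θ, hθ, h⟩ := hz
    have hχη := hχ.mulForm_mem_forms η.2.1
    have hθ' := extend_mem_forms (le_top (a := complement K)) hθ
    obtain ⟨W, hKW, h1⟩ := hχ.eq_one
    obtain ⟨C, hC, hCK, hCθ⟩ := hθ.2.2.2 rfl
    -- From `η ∧ ∂̄χ = ∂̄θ` with `θ` supported off `K`, subtracting `±θ` makes `χη` closed without
    -- changing it near `K`.
    have hβ : mulForm (cutoff E V) η.1 - (-1 : ℂ) ^ (p + q) • θ ∈
        cocycles E F .compact p q (⊤ : Opens X) := by
      refine ⟨sub_mem hχη (Submodule.smul_mem _ _ hθ'), fun x _ => ?_⟩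
      rw [dbar_sub (hχη.2.1 x trivial) ((hθ'.2.1 x trivial).smul _),
        dbar_smul _ (hθ'.2.1 x trivial), sub_eq_zero]
      by_cases hx : x ∈ complement K
      · rw [← h x hx, wedgeCutoff_apply, smul_smul, hs, one_smul]
      · rw [dbar_eq_zero_of_notMem hθ hx, smul_zero]
        exact (hχ.dbar_mulForm_mem_cocycles η.2 V.2).1.1 x hx
    refine ⟨cls E F .compact p q ⊤ ⟨_, hβ⟩, ?_⟩
    rw [jStar_cls]
    refine toGerm_cls_eq (W := ⟨V.1 ⊓ W ⊓ ⟨Cᶜ, hC.isClosed.isOpen_compl⟩,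
      subset_inter (subset_inter V.2 hKW) fun x hx hxC => hCK hxC hx⟩) le_top
      (inf_le_left.trans inf_le_left) fun x hx => ?_
    change mulForm (cutoff E V) η.1 x - (-1 : ℂ) ^ (p + q) • θ x = η.1 x
    rw [mulForm_apply, h1 x hx.1.2, hCθ x hx.2, one_smul, smul_zero, sub_zero]
  · rintro ⟨a, rfl⟩
    obtain ⟨α, rfl⟩ := Submodule.mkQ_surjective _ a
    change connecting E F p q K (jStar E F p q K (cls E F .compact p q ⊤ α)) = 0
    -- A globally defined `α` can serve as its own `θ`, and `∂̄α = 0`.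
    rw [jStar_cls, connecting_toGerm (isCutoff_cutoff (OpenNhd.top K)),
      cls_wedgeCutoff_eq _ _ α.2.1 (W := ⊤) (α := 0) (subset_univ _), map_zero]
    · rw [sub_self, map_zero]
      exact zero_mem _
    · intro x
      rw [α.2.2 x trivial, smul_zero]
      rfl

theorem exact_connecting_iStar (p q : ℕ) (K : Compacts X) :
    Function.Exact (connecting E F p q K) (iStar E F p (q + 1) K) := by
  intro b
  have hs : (-1 : ℂ) ^ (p + q) * (-1 : ℂ) ^ (p + q) = 1 := by
    rw [← mul_pow, neg_one_mul, neg_neg, one_pow]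
  constructor
  · intro hb
    obtain ⟨β, rfl⟩ := Submodule.mkQ_surjective _ b
    obtain ⟨θ, hθ, h⟩ := cls_eq_zero.1 ((iStar_cls β).symm.trans hb)
    obtain ⟨C, hC, hCK, hCβ⟩ := β.2.1.2.2.2 rfl
    -- Off the support of `β = ∂̄θ` the form `θ` is closed; up to sign it represents the germ class
    -- sought, and `θ` is its own compactly supported extension.
    let V : OpenNhd K := ⟨⟨Cᶜ, hC.isClosed.isOpen_compl⟩, fun x hx hxC => hCK hxC hx⟩
    have hθs := Submodule.smul_mem _ ((-1 : ℂ) ^ (p + q)) hθ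
    have hη : (-1 : ℂ) ^ (p + q) • θ ∈ forms E F .all p q (⊤ : Opens X) := forget_mem_forms hθs
    have hη' : restrict E F V.1 ((-1 : ℂ) ^ (p + q) • θ) ∈ cocycles E F .all p q V.1 := by
      refine ⟨restrict_mem_forms le_top hη, fun x hx => ?_⟩
      rw [← dbar_congr (restrict_eventuallyEq _ hx), dbar_smul _ (hθ.2.1 x trivial),
        ← h x trivial]
      exact (congrArg _ (hCβ x hx)).trans (smul_zero _)
    refine ⟨toGerm E F p q V (cls E F .all p q V.1 ⟨_, hη'⟩), ?_⟩
    rw [connecting_toGerm (isCutoff_cutoff V)]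
    refine cls_wedgeCutoff_eq _ _ hθs V.2 ?_ fun x => ?_
    · rw [map_sub, restrict_restrict le_rfl, sub_self]
      exact zero_mem _
    · rw [dbar_smul _ (hθ.2.1 x trivial), smul_smul, hs, one_smul]
      exact h x trivial
  · rintro ⟨z, rfl⟩
    obtain ⟨V, η, rfl⟩ := exists_toGerm_cls z
    have hχ := isCutoff_cutoff (E := E) V
    have hχη := hχ.mulForm_mem_forms η.2.1
    rw [connecting_toGerm hχ, iStar_cls, cls_eq_zero]
    -- On all of `X` the form `±χη` is an admissible primitive, although its support may meet `K`.
    refine ⟨_, Submodule.smul_mem _ ((-1 : ℂ) ^ (p + q)) hχη, fun x _ => ?_⟩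
    rw [dbar_smul _ (hχη.2.1 x trivial)]
    exact wedgeCutoff_apply hχ η x

end Exactness

end Dolbeault

end

theorem theorem7p1 {E : Type*} [NormedAddCommGroup E] [NormedSpace ℂ E] [FiniteDimensional ℂ E]
    {X : Type*} [TopologicalSpace X] [ChartedSpace E X] [IsManifold 𝓘(ℂ, E) ω X]
    [T2Space X] [SecondCountableTopology X] (K : Compacts X) (p : ℕ) :
    ∃ γ : ∀ q : ℕ, Dolbeault.GermCohomology E ℂ p q K →ₗ[ℂ]
        Dolbeault.Cohomology E ℂ .compact p (q + 1) (Dolbeault.complement K),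
      (∀ q, Dolbeault.IsConnectingMap E ℂ p q K (γ q) ∧
        ∀ γ', Dolbeault.IsConnectingMap E ℂ p q K γ' → γ' = γ q) ∧
      Function.Injective (Dolbeault.iStar E ℂ p 0 K) ∧
      ∀ q,
        Function.Exact (Dolbeault.iStar E ℂ p q K) (Dolbeault.jStar E ℂ p q K) ∧
        Function.Exact (Dolbeault.jStar E ℂ p q K) (γ q) ∧
        Function.Exact (γ q) (Dolbeault.iStar E ℂ p (q + 1) K) := by
  refine ⟨fun q => Dolbeault.connecting E ℂ p q K, fun q => ⟨?_, fun γ' h => ?_⟩,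
    Dolbeault.injective_iStar_zero p K, fun q => ⟨Dolbeault.exact_iStar_jStar p q K,
      Dolbeault.exact_jStar_connecting p q K, Dolbeault.exact_connecting_iStar p q K⟩⟩
  · exact Dolbeault.isConnectingMap_connecting p q K
  · exact h.eq (Dolbeault.isConnectingMap_connecting p q K)
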